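/- Let $\lambda>0$ and $\varepsilon>0$, and let $X_1<X_2<\cdots$ be the successive points of a Poisson process of intensity $\lambda$ on $[0,\infty)$, i.e. $X_1, X_2-X_1, X_3-X_2,\dots$ are independent and exponentially distributed with parameter $\lambda$. Let $A_1=X_1$ and, for $i\ge 1$, $$A_{i+1}=\inf\{X_j : j\ge 2,\ X_j>A_i,\ X_j-X_{j-1}>\varepsilon\},\qquad E_i=\inf\{X_j+\varepsilon : j\ge 1,\ X_j\ge A_i,\ X_{j+1}-X_j>\varepsilon\}$$ be the beginning and the end of the $i$-th cluster, $B_i=E_i-A_i$ its length, and $U_n=\sum_{k=1}^n (A_{k+1}-A_k)$ the cumulative length of the first $n$ cycles. For $x\ge 0$ let $p_n(x)=\Pr(\beta_0(x)=n)$, where $\beta_0(x)$ is the number of indices $i$ with $0\le A_i$ and $E_i\le x$ (the number of complete clusters in $[0,x]$). **Theorem (the distributions of $B_i$ and $U_n$).** 1. For every $i\ge1$, the law of $B_i$ is $e^{-\varepsilon\lambda}\,\delta_\varepsilon+f_{B_i}(x)\,dx$, where $\delta_\varepsilon$ is the Dirac mass at $\varepsilon$ and $$f_{B_i}(x)=\left[\lambda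 e^{-\varepsilon\lambda}\,p_0(x-\varepsilon)+e^{-\varepsilon\lambda}\,p_0'(x-\varepsilon)\right]\mathbf 1_{\{x>\varepsilon\}}\ \ge 0$$ (at the single point $x=2\varepsilon$, where $p_0'(x-\varepsilon)$ does not exist, it is read as $0$). 2. For every $n\ge1$, the law of $U_n$ is absolutely continuous with density $$f_{U_n}(x)=\lambda e^{-\varepsilon\lambda}\,p_{n-1}(x-\varepsilon)\,\mathbf 1_{\{x>\varepsilon\}}.$$ 3. Here, for all $n\ge 0$ and $x\ge 0$ (with $0^0=1$, and an empty sum being $0$), $$p_n(x)=\frac1{n!}\sum_{i=0}^{\lfloor x/\varepsilon\rfloor-n}\frac{(-1)^i}{i!}\left((x-(n+i)\varepsilon)\,\lambda e^{-\lambda\varepsilon}\right)^{n+i},$$ and $p_0$ is differentiable at every $x>0$ with $x\ne\varepsilon$, with $$p_0'(x)=\sum_{i=1}^{\lfloor x/\varepsilon\rfloor}\frac{(-1)^i}{(i-1)!}\,\lambda e^{-\lambda\varepsilon}\left((x-i\varepsilon)\,\lambda e^{-\lambda\varepsilon}\right)^{i-1}.$$ -/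

import Mathlib

open MeasureTheory ProbabilityTheory

noncomputable section

namespace SensorClusters

/-- The gap sequence of a sequence of points `x 0, x 1, …` of the half-line: the distance from the
origin to the first point, followed by the distances between consecutive points. -/
def gap (x : ℕ → ℝ) : ℕ → ℝ
  | 0 => x 0
  | j + 1 => x (j + 1) - x j

/-- `X 0, X 1, …` are the successive points of a homogeneous Poisson process of intensity `lam` on
the half-line `[0, ∞)`: the first point and the distances between consecutive points are
independent, exponentially distributed random variables of parameter `lam`. -/
structure IsPoissonProcess {Ω : Type*} [MeasurableSpace Ω] (P : Measure Ω) (lam : ℝ)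
    (X : ℕ → Ω → ℝ) : Prop where
  measurable : ∀ j, Measurable (X j)
  indep : iIndepFun (fun (j : ℕ) (ω : Ω) => gap (fun k => X k ω) j) P
  law : ∀ j, HasLaw (fun ω => gap (fun k => X k ω) j) (expMeasure lam) P

/-- The beginning of each cluster (clusters are numbered from `0`): the first cluster begins at
the first point; the next one begins at the first later point whose distance to its predecessor
exceeds `ε`. -/
def clusterStart (ε : ℝ) (x : ℕ → ℝ) : ℕ → ℝ
  | 0 => x 0
  | i + 1 => sInf {y | ∃ j, y = x (j + 1) ∧ clusterStart ε x i < x (j + 1) ∧ ε < x (j + 1) - x j}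

/-- The end of the `i`-th cluster: `ε` plus the first point, not before the beginning of the
cluster, whose successor is at a distance exceeding `ε`. -/
def clusterEnd (ε : ℝ) (x : ℕ → ℝ) (i : ℕ) : ℝ :=
  sInf {y | ∃ j, y = x j + ε ∧ clusterStart ε x i ≤ x j ∧ ε < x (j + 1) - x j}

/-- The length of the `i`-th cluster. -/
def clusterLength (ε : ℝ) (x : ℕ → ℝ) (i : ℕ) : ℝ :=
  clusterEnd ε x i - clusterStart ε x i

/-- The cumulative length of the first `n` cycles, a cycle being the distance between the
beginnings of two consecutive clusters. -/
def cycleSum (ε : ℝ) (x : ℕ → ℝ) (n : ℕ) : ℝ :=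
  ∑ k ∈ Finset.range n, (clusterStart ε x (k + 1) - clusterStart ε x k)

/-- The number of complete clusters in `[0, t]`. -/
def completeClusters (ε : ℝ) (x : ℕ → ℝ) (t : ℝ) : ℕ∞ :=
  {i : ℕ | 0 ≤ clusterStart ε x i ∧ clusterEnd ε x i ≤ t}.encard

/-- The probability that `[0, t]` contains exactly `n` complete clusters. -/
def clusterProb {Ω : Type*} [MeasurableSpace Ω] (P : Measure Ω) (X : ℕ → Ω → ℝ) (ε : ℝ)
    (n : ℕ) (t : ℝ) : ℝ :=
  P.real {ω | completeClusters ε (fun j => X j ω) t = (n : ℕ∞)}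

/-- The formula for the density of the length of a cluster on `(ε, ∞)`, in terms of
`p₀ = p 0`. -/
def clusterLengthDensity (lam ε : ℝ) (p : ℕ → ℝ → ℝ) (x : ℝ) : ℝ :=
  Set.indicator (Set.Ioi ε)
    (fun x => lam * Real.exp (-(ε * lam)) * p 0 (x - ε)
      + Real.exp (-(ε * lam)) * deriv (p 0) (x - ε)) x

/-- The formula for the density of the cumulative length of `n ≥ 1` cycles, in terms of
`p (n - 1)`. -/
def cycleSumDensity (lam ε : ℝ) (p : ℕ → ℝ → ℝ) (n : ℕ) (x : ℝ) : ℝ :=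
  Set.indicator (Set.Ioi ε) (fun x => lam * Real.exp (-(ε * lam)) * p (n - 1) (x - ε)) x

end SensorClusters

end

/-!
A cluster is read off the gap sequence `g` of the Poisson process, a sequence of independent
exponential variables of parameter `λ`. If `h` is the sequence of the gaps that follow the first
point of a cluster, then the length of the cluster is `ε` plus the sum of the gaps before the first
one that exceeds `ε` (`lengthOfGaps`), and from its end one sees the points with gap sequence
`gapsAfter ε h`, in which the long gap is diminished by `ε`. The exponential law has no memory, so
`gapsAfter` preserves the law of the gap sequence (`measurePreserving_gapsAfter`); therefore all
clusters have the same length in law. Ends and beginnings of clusters satisfy recursions of the form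
`g 0 + (lengthOfGaps ε h + V (gapsAfter ε h))` with `h = tailSeq g` (`clusterEnd_succ`,
`clusterStart_succ`).

Conditioning on the first term of `h`, which either ends the cluster or moves its beginning, gives
the distribution function `w` of `lengthOfGaps ε h + V (gapsAfter ε h)` the renewal equation
`w(x) = exp (-ελ) v(x - ε) + ∫_{u ≤ ε} w(x - u)`, where `v` is the distribution function of `V` and
the integral is over the exponential law (`gapCdf_lengthOfGaps_add`). The exponential law gives
`[0, ε]` a mass less than `1`, so the equation determines `w` (`eqOn_of_renewal`), and it remains to
guess a solution.

With `c = λ exp (-λε)`, the truncated powers `T_k(x) = (c (x - kε))₊ᵏ / k!` satisfy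
`T_{k+1}'(x) = c T_k(x - ε)`. The alternating sums `P_n = ∑_k (-1)^(k+n) C(k,n) T_k` (`probSum`) and
`F_n = ∑_j (-1)^(j+n) C(j,n) T_{j+1}` (`cdfSum`) therefore satisfy `F_n'(x) = c P_n(x - ε)`, and
`P_n = F_{n-1} - F_n` by Pascal's rule, where `F_{-1} = T_0`. Hence `λ exp (λx) G_n(x)`, where
`G_n(x) = F_n(x) + exp (-ελ) P_n(x - ε)` (`renewalSum`), is the derivative of `exp (λx) F_n(x)`.
This evaluates the integrals of `G_n` against the exponential law and shows that `G_n` solves the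
renewal equation for `v = F_{n-1}`, and that adding an exponential variable turns `G_n` into `F_n`.
By induction `F_n` is the distribution function of the end of the `n`-th cluster
(`gapCdf_endOfGaps`), clusters being numbered from `0`, and a similar induction shows that it is
also that of the length of the first `n + 1` cycles (`gapCdf_cycleSum`). A cluster length has the
distribution function `G_0`.

There are exactly `n` complete clusters in `[0, x]` if the last of the first `n` ends by the time
`x` and the next one does not, so that `p_n = F_{n-1} - F_n = P_n` on `[0, ∞)`
(`clusterProb_eq_probSum`). The densities are the derivatives of the distribution functions, and
they are nonnegative because distribution functions increase.
-/

namespace SensorClusters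

open Set Filter Topology

/-! ### Truncated powers and the explicit distribution functions -/

/-- The truncated power `(c (x - kε))₊ᵏ / k!`, which for `k = 0` is the indicator of `[0, ∞)`.
It is the expected number of `k`-element sets of complete clusters in `[0, x]`. -/
noncomputable def truncPow (c ε : ℝ) (k : ℕ) (x : ℝ) : ℝ :=
  if k * ε ≤ x then (c * (x - k * ε)) ^ k / k.factorial else 0

/-- The explicit expression of `p_n`, the alternating series of truncated powers cut at index `N`.
The omitted terms vanish at all points `x < Nε`. -/
noncomputable def probSum (c ε : ℝ) (N n : ℕ) (x : ℝ) : ℝ :=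
  ∑ k ∈ Finset.range N, (-1) ^ (k + n) * (k.choose n : ℝ) * truncPow c ε k x

/-- The explicit expression of the distribution function of the end of the `n`-th cluster
(clusters being numbered from `0`), cut at index `N` like `probSum`. -/
noncomputable def cdfSum (c ε : ℝ) (N n : ℕ) (x : ℝ) : ℝ :=
  ∑ j ∈ Finset.range N, (-1) ^ (j + n) * (j.choose n : ℝ) * truncPow c ε (j + 1) x

section TruncPow

variable {c ε : ℝ}

lemma truncPow_of_lt {k : ℕ} {x : ℝ} (h : x < k * ε) : truncPow c ε k x = 0 := by
  simp [truncPow, not_le.mpr h]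

lemma truncPow_of_le {k : ℕ} {x : ℝ} (h : k * ε ≤ x) :
    truncPow c ε k x = (c * (x - k * ε)) ^ k / k.factorial := by
  simp [truncPow, h]

lemma truncPow_succ_of_le {k : ℕ} {x : ℝ} (h : x ≤ (k + 1 : ℕ) * ε) :
    truncPow c ε (k + 1) x = 0 := by
  rcases h.lt_or_eq with h | h
  · exact truncPow_of_lt h
  · rw [truncPow_of_le h.ge, h]; simp

lemma truncPow_zero_of_nonneg {x : ℝ} (h : 0 ≤ x) : truncPow c ε 0 x = 1 := by
  simp [truncPow, h]

lemma truncPow_zero_of_neg {x : ℝ} (h : x < 0) : truncPow c ε 0 x = 0 := by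
  simp [truncPow, h]

lemma truncPow_nonneg (hc : 0 ≤ c) (k : ℕ) (x : ℝ) : 0 ≤ truncPow c ε k x := by
  unfold truncPow
  split_ifs with h
  · have : 0 ≤ x - k * ε := by linarith
    positivity
  · exact le_rfl

lemma monotone_truncPow (hc : 0 ≤ c) (k : ℕ) : Monotone (truncPow c ε k) := by
  intro x y hxy
  rcases lt_or_ge x (k * ε) with h | h
  · rw [truncPow_of_lt h]; exact truncPow_nonneg hc k y
  · rw [truncPow_of_le h, truncPow_of_le (h.trans hxy)]
    have : 0 ≤ x - k * ε := by linarith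
    gcongr

/-- Away from the jump of `truncPow c ε 0`, differentiation lowers the index and shifts. -/
lemma hasDerivAt_truncPow_succ (k : ℕ) {x : ℝ} (hx : k ≠ 0 ∨ x ≠ ε) :
    HasDerivAt (truncPow c ε (k + 1)) (c * truncPow c ε k (x - ε)) x := by
  set a : ℝ := (k + 1 : ℕ) * ε with ha
  have hak : ∀ y, y - a = y - ε - k * ε := fun y => by rw [ha]; push_cast; ring
  have hpoly : ∀ y, HasDerivAt (fun y => (c * (y - a)) ^ (k + 1) / (k + 1).factorial)
      (c * ((c * (y - a)) ^ k / k.factorial)) y := by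
    intro y
    have h1 : HasDerivAt (fun y => c * (y - a)) c y := by
      simpa using ((hasDerivAt_id y).sub_const a).const_mul c
    refine ((h1.pow (k + 1)).div_const _).congr_deriv ?_
    have : (k.factorial : ℝ) ≠ 0 := by positivity
    have : (k : ℝ) + 1 ≠ 0 := by positivity
    rw [Nat.factorial_succ]; push_cast
    field_simp
  rcases lt_trichotomy x a with h | h | h
  · have h0 : truncPow c ε k (x - ε) = 0 := truncPow_of_lt (by have := hak x; linarith)
    rw [h0, mul_zero]
    refine (hasDerivAt_const x (0 : ℝ)).congr_of_eventuallyEq ?_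
    filter_upwards [gt_mem_nhds h] with y hy
    exact truncPow_of_lt hy
  · have hk : k ≠ 0 := by
      rcases hx with hx | hx
      · exact hx
      · rintro rfl
        exact hx (by rw [h, ha]; simp)
    obtain ⟨m, rfl⟩ := Nat.exists_eq_succ_of_ne_zero hk
    have h0 : truncPow c ε (m + 1) (x - ε) = 0 :=
      truncPow_succ_of_le (by have := hak x; simp only [Nat.succ_eq_add_one] at this; linarith)
    simp only [Nat.succ_eq_add_one] at *
    rw [h0, mul_zero]
    have hl : HasDerivWithinAt (truncPow c ε (m + 1 + 1)) 0 (Iic x) x := by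
      refine (hasDerivWithinAt_const x (Iic x) (0 : ℝ)).congr (fun y hy => ?_) ?_
      · exact truncPow_succ_of_le (le_trans hy h.le)
      · exact truncPow_succ_of_le h.le
    have hr : HasDerivWithinAt (truncPow c ε (m + 1 + 1)) 0 (Ici x) x := by
      have := (hpoly x).hasDerivWithinAt (s := Ici x)
      rw [h, sub_self, mul_zero, zero_pow (by omega), zero_div, mul_zero] at this
      rw [h]
      refine this.congr (fun y hy => truncPow_of_le hy) (truncPow_of_le le_rfl)
    have := hl.union hr
    rwa [Iic_union_Ici, hasDerivWithinAt_univ] at this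
  · have h0 : truncPow c ε k (x - ε) = (c * (x - a)) ^ k / k.factorial := by
      rw [truncPow_of_le (by have := hak x; linarith), hak]
    rw [h0]
    refine (hpoly x).congr_of_eventuallyEq ?_
    filter_upwards [lt_mem_nhds h] with y hy
    exact truncPow_of_le hy.le

lemma continuous_truncPow_succ (k : ℕ) : Continuous (truncPow c ε (k + 1)) := by
  set a : ℝ := (k + 1 : ℕ) * ε with ha
  have : truncPow c ε (k + 1) = fun x => (c * max (x - a) 0) ^ (k + 1) / (k + 1).factorial := by
    funext x
    rcases le_total x a with h | h
    · rw [truncPow_succ_of_le h, max_eq_right (by linarith)]; simp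
    · rw [truncPow_of_le h, max_eq_left (by linarith)]
  rw [this]
  fun_prop

lemma hasDerivAt_cdfSum (N n : ℕ) {x : ℝ} (hx : x ≠ ε) :
    HasDerivAt (cdfSum c ε N n) (c * probSum c ε N n (x - ε)) x := by
  have := HasDerivAt.fun_sum (u := Finset.range N) (x := x)
    (A := fun j x => (-1) ^ (j + n) * (j.choose n : ℝ) * truncPow c ε (j + 1) x)
    (fun j _ => (hasDerivAt_truncPow_succ (c := c) j (Or.inr hx)).const_mul
      ((-1) ^ (j + n) * (j.choose n : ℝ)))
  refine this.congr_deriv ?_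
  rw [probSum, Finset.mul_sum]
  exact Finset.sum_congr rfl fun j _ => by ring

lemma continuous_cdfSum (N n : ℕ) : Continuous (cdfSum c ε N n) :=
  continuous_finsetSum _ fun j _ => continuous_const.mul (continuous_truncPow_succ j)

lemma cdfSum_of_le (hε : 0 < ε) (N n : ℕ) {x : ℝ} (hx : x ≤ ε) : cdfSum c ε N n x = 0 := by
  refine Finset.sum_eq_zero fun j _ => ?_
  rw [truncPow_succ_of_le, mul_zero]
  push_cast
  nlinarith [mul_nonneg (Nat.cast_nonneg (α := ℝ) j) hε.le]

lemma probSum_of_neg (hε : 0 < ε) (N n : ℕ) {x : ℝ} (hx : x < 0) : probSum c ε N n x = 0 := by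
  refine Finset.sum_eq_zero fun j _ => ?_
  rw [truncPow_of_lt, mul_zero]
  exact hx.trans_le (by positivity)

/-- The cut-off index of `probSum` is irrelevant to the left of it. -/
lemma probSum_eq_of_lt (hε : 0 < ε) {N M : ℕ} (n : ℕ) (hNM : N ≤ M) {x : ℝ} (hx : x < N * ε) :
    probSum c ε M n x = probSum c ε N n x := by
  refine (Finset.sum_subset (Finset.range_mono hNM) fun k _ hk => ?_).symm
  rw [truncPow_of_lt, mul_zero]
  have : (N : ℝ) ≤ k := by exact_mod_cast not_lt.mp (fun h => hk (Finset.mem_range.mpr h))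
  exact hx.trans_le (by gcongr)

lemma probSum_zero_add_cdfSum (N : ℕ) (x : ℝ) :
    probSum c ε (N + 1) 0 x + cdfSum c ε N 0 x = truncPow c ε 0 x := by
  rw [probSum, Finset.sum_range_succ', cdfSum, add_right_comm, ← Finset.sum_add_distrib,
    Finset.sum_eq_zero]
  · simp
  · intro j _
    simp only [Nat.choose_zero_right, add_zero, pow_succ]
    ring

/-- Pascal's rule in the form: `p_n` is the difference of two successive distribution
functions. -/
lemma probSum_succ_add_cdfSum (N n : ℕ) (x : ℝ) :
    probSum c ε (N + 1) (n + 1) x + cdfSum c ε N (n + 1) x = cdfSum c ε N n x := by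
  rw [probSum, Finset.sum_range_succ', cdfSum, cdfSum, add_right_comm, ← Finset.sum_add_distrib]
  simp only [Nat.choose_zero_succ, Nat.cast_zero, mul_zero, zero_mul, add_zero]
  refine Finset.sum_congr rfl fun j _ => ?_
  rw [Nat.choose_succ_succ]
  push_cast
  ring

end TruncPow

/-! ### Functions bounded on left half-lines -/

/-- Measurable functions on the line that are bounded on every half-line `(-∞, X]`. These are the
functions that can be integrated against a probability measure carried by `[0, ∞)` after the
substitution `u ↦ x - u`. -/
structure LeftBounded (h : ℝ → ℝ) : Prop where
  measurable : Measurable h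
  bound : ∀ X, ∃ M, ∀ x ≤ X, |h x| ≤ M

lemma Monotone.leftBounded {h : ℝ → ℝ} (hm : Monotone h) (h0 : ∀ x, 0 ≤ h x) : LeftBounded h where
  measurable := hm.measurable
  bound X := ⟨h X, fun x hx => by rw [abs_of_nonneg (h0 x)]; exact hm hx⟩

namespace LeftBounded

variable {f g : ℝ → ℝ}

lemma add (hf : LeftBounded f) (hg : LeftBounded g) : LeftBounded (fun x => f x + g x) where
  measurable := hf.measurable.add hg.measurable
  bound X := by
    obtain ⟨A, hA⟩ := hf.bound X
    obtain ⟨B, hB⟩ := hg.bound X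
    exact ⟨A + B, fun x hx => (abs_add_le _ _).trans (add_le_add (hA x hx) (hB x hx))⟩

lemma const_mul (hf : LeftBounded f) (a : ℝ) : LeftBounded (fun x => a * f x) where
  measurable := hf.measurable.const_mul a
  bound X := by
    obtain ⟨A, hA⟩ := hf.bound X
    exact ⟨|a| * A, fun x hx => by rw [abs_mul]; gcongr; exact hA x hx⟩

lemma sub (hf : LeftBounded f) (hg : LeftBounded g) : LeftBounded (fun x => f x - g x) := by
  simpa [sub_eq_add_neg] using hf.add (hg.const_mul (-1))

lemma comp_sub (hf : LeftBounded f) (a : ℝ) : LeftBounded (fun x => f (x - a)) where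
  measurable := hf.measurable.comp (measurable_id.sub_const a)
  bound X := by
    obtain ⟨A, hA⟩ := hf.bound (X - a)
    exact ⟨A, fun x hx => hA _ (by linarith)⟩

lemma sum {ι : Type*} (s : Finset ι) {F : ι → ℝ → ℝ} (h : ∀ i ∈ s, LeftBounded (F i)) :
    LeftBounded (fun x => ∑ i ∈ s, F i x) where
  measurable := Finset.measurable_fun_sum s fun i hi => (h i hi).measurable
  bound X := by
    choose! M hM using fun i hi => (h i hi).bound X
    exact ⟨∑ i ∈ s, M i, fun x hx => (Finset.abs_sum_le_sum_abs _ _).trans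
      (Finset.sum_le_sum fun i hi => hM i hi x hx)⟩

lemma truncPow {c : ℝ} (ε : ℝ) (hc : 0 ≤ c) (k : ℕ) : LeftBounded (truncPow c ε k) :=
  Monotone.leftBounded (monotone_truncPow hc k) (truncPow_nonneg hc k)

lemma probSum {c : ℝ} (ε : ℝ) (hc : 0 ≤ c) (N n : ℕ) : LeftBounded (probSum c ε N n) :=
  sum _ fun k _ => (truncPow ε hc k).const_mul _

lemma cdfSum {c : ℝ} (ε : ℝ) (hc : 0 ≤ c) (N n : ℕ) : LeftBounded (cdfSum c ε N n) :=
  sum _ fun k _ => (truncPow ε hc (k + 1)).const_mul _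

lemma intervalIntegrable (hf : LeftBounded f) (a b : ℝ) : IntervalIntegrable f volume a b := by
  obtain ⟨M, hM⟩ := hf.bound (max a b)
  rw [intervalIntegrable_iff]
  refine Measure.integrableOn_of_bounded (M := M) (by simp) hf.measurable.aestronglyMeasurable ?_
  filter_upwards [ae_restrict_mem measurableSet_uIoc] with x hx
  exact hM x hx.2

end LeftBounded

/-! ### The exponential law -/

section ExpMeasure

variable {lam ε : ℝ}

lemma expMeasure_real_Iic (hlam : 0 < lam) {x : ℝ} (hx : 0 ≤ x) :
    (expMeasure lam).real (Iic x) = 1 - Real.exp (-(lam * x)) := by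
  have := isProbabilityMeasure_expMeasure hlam
  rw [← cdf_eq_real, cdf_expMeasure_eq hlam, if_pos hx]

lemma ae_pos_expMeasure (hlam : 0 < lam) : ∀ᵐ u ∂(expMeasure lam), 0 < u := by
  have := isProbabilityMeasure_expMeasure hlam
  have h : (expMeasure lam) (Iic 0) = 0 := by
    have := expMeasure_real_Iic hlam le_rfl
    rw [measureReal_def] at this
    simpa [ENNReal.toReal_eq_zero_iff] using this
  filter_upwards [measure_eq_zero_iff_ae_notMem.mp h] with u hu
  simpa using hu

/-- The exponential law has no memory. -/
lemma expMeasure_restrict_Ioi (hlam : 0 < lam) (hε : 0 < ε) :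
    (expMeasure lam).restrict (Ioi ε) =
      ENNReal.ofReal (Real.exp (-(ε * lam))) • (expMeasure lam).map (fun u => u + ε) := by
  have := isProbabilityMeasure_expMeasure hlam
  have hm : Measurable fun u : ℝ => u + ε := measurable_id.add_const ε
  have : IsProbabilityMeasure ((expMeasure lam).map (fun u => u + ε)) :=
    Measure.isProbabilityMeasure_map hm.aemeasurable
  refine Measure.ext_of_Iic _ _ fun a => ?_
  have hpre : (fun u : ℝ => u + ε) ⁻¹' Iic a = Iic (a - ε) := by
    ext u; simp [le_sub_iff_add_le]
  rw [Measure.restrict_apply measurableSet_Iic, Measure.smul_apply,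
    Measure.map_apply hm measurableSet_Iic, hpre, inter_comm, Ioi_inter_Iic, smul_eq_mul]
  have hneg : ∀ b < 0, (expMeasure lam) (Iic b) = 0 := fun b hb => by
    refine measure_mono_null (fun x (hx : x ≤ b) => ?_)
      (ae_iff.mp (ae_pos_expMeasure hlam))
    simpa using hx.trans hb.le
  rcases lt_or_ge a ε with h | h
  · rw [Ioc_eq_empty (not_lt.mpr h.le), measure_empty, hneg _ (by linarith), mul_zero]
  · rw [← ENNReal.toReal_eq_toReal_iff' (by finiteness) (by finiteness), ENNReal.toReal_mul,
      ENNReal.toReal_ofReal (Real.exp_pos _).le, ← measureReal_def, ← measureReal_def,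
      expMeasure_real_Iic hlam (sub_nonneg.mpr h),
      show Ioc ε a = Iic a \ Iic ε by ext; simp [and_comm],
      measureReal_sdiff (Iic_subset_Iic.mpr h) measurableSet_Iic,
      expMeasure_real_Iic hlam (hε.le.trans h), expMeasure_real_Iic hlam hε.le, mul_sub,
      ← Real.exp_add]
    ring_nf

lemma setIntegral_Ioi_expMeasure (hlam : 0 < lam) (hε : 0 < ε) (f : ℝ → ℝ) :
    ∫ u in Ioi ε, f u ∂(expMeasure lam) =
      Real.exp (-(ε * lam)) * ∫ u, f (u + ε) ∂(expMeasure lam) := by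
  rw [expMeasure_restrict_Ioi hlam hε, integral_smul_measure,
    (measurableEmbedding_addRight ε).integral_map, ENNReal.toReal_ofReal (Real.exp_pos _).le,
    smul_eq_mul]

lemma setIntegral_Iic_expMeasure (hlam : 0 < lam) {y : ℝ} (hy : 0 ≤ y) (f : ℝ → ℝ) :
    ∫ u in Iic y, f u ∂(expMeasure lam) =
      ∫ u in (0 : ℝ)..y, lam * Real.exp (-(lam * u)) * f u := by
  have h1 : ∫ u in Iic y, f u ∂(expMeasure lam) =
      ∫ u in Iic y, (Ioi (0:ℝ)).indicator f u ∂(expMeasure lam) := by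
    refine integral_congr_ae (ae_restrict_of_ae ?_)
    filter_upwards [ae_pos_expMeasure hlam] with u hu
    rw [indicator_of_mem (show u ∈ Ioi (0:ℝ) from hu)]
  have h2 : expMeasure lam = volume.withDensity (exponentialPDF lam) := rfl
  have h3 : Measurable (exponentialPDF lam) :=
    (measurable_exponentialPDFReal lam).ennreal_ofReal
  rw [h1, setIntegral_indicator measurableSet_Ioi, inter_comm, Ioi_inter_Iic, h2,
    restrict_withDensity measurableSet_Ioc,
    integral_withDensity_eq_integral_toReal_smul h3
      (Eventually.of_forall fun x => ENNReal.ofReal_lt_top),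
    intervalIntegral.integral_of_le hy]
  refine setIntegral_congr_fun measurableSet_Ioc fun u hu => ?_
  simp only [exponentialPDF_of_nonneg hu.1.le, smul_eq_mul]
  rw [ENNReal.toReal_ofReal (by positivity)]

lemma LeftBounded.integrable (hlam : 0 < lam) {h : ℝ → ℝ} (hh : LeftBounded h) (x : ℝ) :
    Integrable (fun u => h (x - u)) (expMeasure lam) := by
  have := isProbabilityMeasure_expMeasure hlam
  obtain ⟨M, hM⟩ := hh.bound x
  refine Integrable.of_bound
    (hh.measurable.comp (measurable_const.sub measurable_id)).aestronglyMeasurable M ?_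
  filter_upwards [ae_pos_expMeasure hlam] with u hu
  exact hM _ (by linarith)

/-- Integration against the part of the exponential law carried by `[0, ε]` is a contraction on
functions bounded on `(-∞, X]`, so that it has no fixed point but `0`. -/
lemma eq_zero_of_eq_setIntegral_Iic (hlam : 0 < lam) (hε : 0 < ε) {D : ℝ → ℝ} {X M : ℝ}
    (hM : ∀ x ≤ X, |D x| ≤ M)
    (hD : ∀ x ≤ X, D x = ∫ u in Iic ε, D (x - u) ∂(expMeasure lam)) {x : ℝ} (hx : x ≤ X) :
    D x = 0 := by
  have := isProbabilityMeasure_expMeasure hlam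
  set r := (expMeasure lam).real (Iic ε)
  have hr0 : 0 ≤ r := measureReal_nonneg
  have hr1 : r < 1 := by
    have := expMeasure_real_Iic hlam hε.le
    have := Real.exp_pos (-(lam * ε))
    linarith
  have key : ∀ m : ℕ, ∀ x ≤ X, |D x| ≤ M * r ^ m := by
    intro m
    induction m with
    | zero => simpa using hM
    | succ m ih =>
      intro x hx
      rw [hD x hx, pow_succ, ← mul_assoc]
      have hbd : ∀ᵐ u ∂(expMeasure lam).restrict (Iic ε), ‖D (x - u)‖ ≤ M * r ^ m := by
        refine ae_restrict_of_ae ?_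
        filter_upwards [ae_pos_expMeasure hlam] with u hu
        exact ih _ (by linarith)
      exact norm_setIntegral_le_of_norm_le_const_ae (measure_lt_top _ _) hbd
  have hlim : Tendsto (fun m : ℕ => M * r ^ m) atTop (𝓝 (M * 0)) :=
    (tendsto_pow_atTop_nhds_zero_of_lt_one hr0 hr1).const_mul M
  rw [mul_zero] at hlim
  exact abs_nonpos_iff.mp (ge_of_tendsto' hlim fun m => key m x hx)

/-- Two solutions of the renewal equation `w = a + ∫ w (· - u)`, the integral being over the
exponential law on `[0, ε]`, agree. -/
lemma eqOn_of_renewal (hlam : 0 < lam) (hε : 0 < ε) {w g a : ℝ → ℝ} {X : ℝ}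
    (hw : LeftBounded w) (hg : LeftBounded g)
    (h1 : ∀ x ≤ X, w x = a x + ∫ u in Iic ε, w (x - u) ∂(expMeasure lam))
    (h2 : ∀ x ≤ X, g x = a x + ∫ u in Iic ε, g (x - u) ∂(expMeasure lam)) {x : ℝ} (hx : x ≤ X) :
    w x = g x := by
  obtain ⟨M, hM⟩ := (hw.sub hg).bound X
  refine sub_eq_zero.mp
    (eq_zero_of_eq_setIntegral_Iic hlam hε (D := fun x => w x - g x) hM (fun x hx => ?_) hx)
  rw [integral_sub (hw.integrable hlam x).integrableOn (hg.integrable hlam x).integrableOn,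
    h1 x hx, h2 x hx]
  ring

/-- The part of the exponential law on `[0, ε]`, expressed through the whole law. -/
lemma setIntegral_Iic_eq_sub (hlam : 0 < lam) (hε : 0 < ε) {h : ℝ → ℝ} (hh : LeftBounded h)
    (x : ℝ) :
    ∫ u in Iic ε, h (x - u) ∂(expMeasure lam) =
      ∫ u, h (x - u) ∂(expMeasure lam)
        - Real.exp (-(ε * lam)) * ∫ u, h (x - ε - u) ∂(expMeasure lam) := by
  have h1 := integral_add_compl (measurableSet_Iic (a := ε)) (hh.integrable hlam x)
  rw [compl_Iic, setIntegral_Ioi_expMeasure hlam hε] at h1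
  have h2 : ∀ u, x - ε - u = x - (u + ε) := fun u => by ring
  simp only [h2]
  linarith

end ExpMeasure

/-! ### The renewal equations solved by the explicit functions -/

section Renewal

variable {lam ε : ℝ}

/-- The function `F + F' / λ`, where `F` is `cdfSum c ε N n` and `c = λ exp (-ελ)`. It is the
distribution function of the difference of the end of the `n`-th cluster and of the first point:
this difference is a variable to which an independent exponential variable has to be added to
give the distribution function `F`. -/
noncomputable def renewalSum (lam ε : ℝ) (N n : ℕ) (x : ℝ) : ℝ :=
  cdfSum (lam * Real.exp (-(ε * lam))) ε N n x
    + Real.exp (-(ε * lam)) * probSum (lam * Real.exp (-(ε * lam))) ε N n (x - ε)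

lemma LeftBounded.renewalSum (hlam : 0 < lam) (ε : ℝ) (N n : ℕ) :
    LeftBounded (renewalSum lam ε N n) := by
  have hc : 0 ≤ lam * Real.exp (-(ε * lam)) := by positivity
  exact (LeftBounded.cdfSum ε hc N n).add (((LeftBounded.probSum ε hc N n).comp_sub ε).const_mul _)

lemma renewalSum_of_lt (hε : 0 < ε) (N n : ℕ) {x : ℝ} (hx : x < ε) :
    renewalSum lam ε N n x = 0 := by
  rw [renewalSum, cdfSum_of_le hε N n hx.le, probSum_of_neg hε N n (by linarith)]; simp

lemma setIntegral_renewalSum (hlam : 0 < lam) (N n : ℕ) (x : ℝ) {y : ℝ} (hy : 0 ≤ y) :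
    ∫ u in Iic y, renewalSum lam ε N n (x - u) ∂(expMeasure lam) =
      cdfSum (lam * Real.exp (-(ε * lam))) ε N n x
        - Real.exp (-(lam * y)) * cdfSum (lam * Real.exp (-(ε * lam))) ε N n (x - y) := by
  set c := lam * Real.exp (-(ε * lam)) with hc
  -- The integrand has the antiderivative `-exp (-λu) F (x - u)`, except at the jump `u = x - ε`.
  rw [setIntegral_Iic_expMeasure hlam hy,
    integral_eq_of_hasDerivAt_off_countable
      (fun u => -(Real.exp (-(lam * u)) * cdfSum c ε N n (x - u))) _ (countable_singleton (x - ε))]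
  · simp; ring
  · have := continuous_cdfSum (c := c) (ε := ε) N n
    fun_prop
  · rintro u ⟨-, hu⟩
    have hne : x - u ≠ ε := fun h => hu (by rw [mem_singleton_iff]; linarith)
    have h1 : HasDerivAt (fun u => cdfSum c ε N n (x - u))
        (c * probSum c ε N n (x - u - ε) * (-1)) u :=
      HasDerivAt.comp u (hasDerivAt_cdfSum (c := c) N n hne) ((hasDerivAt_id u).const_sub x)
    have h2 : HasDerivAt (fun u => Real.exp (-(lam * u))) (Real.exp (-(lam * u)) * (-lam)) u := by
      simpa using ((hasDerivAt_id u).const_mul lam).neg.exp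
    refine (h2.mul h1).neg.congr_deriv ?_
    rw [renewalSum, ← hc, hc]
    ring
  · refine IntervalIntegrable.continuousOn_mul ?_ (by fun_prop)
    simpa using ((LeftBounded.renewalSum hlam ε N n).intervalIntegrable (x - 0) (x - y)).comp_sub_left
      (c := x)

/-- Adding an exponential variable turns `renewalSum` into `cdfSum`. -/
lemma integral_renewalSum (hlam : 0 < lam) (hε : 0 < ε) (N n : ℕ) (x : ℝ) :
    ∫ u, renewalSum lam ε N n (x - u) ∂(expMeasure lam) =
      cdfSum (lam * Real.exp (-(ε * lam))) ε N n x := by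
  have h : ∫ u in Iic (max x 0), renewalSum lam ε N n (x - u) ∂(expMeasure lam) =
      ∫ u, renewalSum lam ε N n (x - u) ∂(expMeasure lam) := by
    refine setIntegral_eq_integral_of_forall_compl_eq_zero fun u hu => ?_
    refine renewalSum_of_lt hε N n ?_
    have := le_max_left x 0
    simp only [mem_Iic, not_le] at hu
    linarith
  rw [← h, setIntegral_renewalSum hlam N n x (le_max_right x 0),
    cdfSum_of_le hε (x := x - max x 0) N n (by linarith [le_max_left x 0])]
  ring

end Renewal

/-! ### Gap sequences and the removal of a cluster -/

/-- The sequence with a given first term and a given tail. -/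
def consSeq (p : ℝ × (ℕ → ℝ)) : ℕ → ℝ
  | 0 => p.1
  | k + 1 => p.2 k

/-- The sequence without its first term. -/
def tailSeq (h : ℕ → ℝ) : ℕ → ℝ := fun k => h (k + 1)

/-- The index of the first gap exceeding `ε` (and `0` if there is none). -/
noncomputable def firstLong (ε : ℝ) (h : ℕ → ℝ) : ℕ := sInf {k | ε < h k}

/-- The length of a cluster, in terms of the sequence `h` of the gaps that follow its first
point. -/
noncomputable def lengthOfGaps (ε : ℝ) (h : ℕ → ℝ) : ℝ :=
  ∑ k ∈ Finset.range (firstLong ε h), h k + ε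

/-- The gap sequence of the points seen from the end of a cluster, in terms of the sequence `h` of
the gaps that follow the first point of the cluster: the first gap exceeding `ε`, diminished by
`ε`, and the gaps after it. -/
noncomputable def gapsAfter (ε : ℝ) (h : ℕ → ℝ) : ℕ → ℝ
  | 0 => h (firstLong ε h) - ε
  | k + 1 => h (firstLong ε h + (k + 1))

section Deterministic

variable {ε : ℝ}

lemma firstLong_spec {h : ℕ → ℝ} (hh : ∃ k, ε < h k) : ε < h (firstLong ε h) :=
  Nat.sInf_mem (s := {k | ε < h k}) hh

lemma le_of_lt_firstLong {h : ℕ → ℝ} {k : ℕ} (hk : k < firstLong ε h) : h k ≤ ε :=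
  not_lt.mp (Nat.notMem_of_lt_sInf (s := {k | ε < h k}) hk)

lemma firstLong_eq {h : ℕ → ℝ} {m : ℕ} (hm : ε < h m) (hlt : ∀ k < m, h k ≤ ε) :
    firstLong ε h = m := by
  rcases lt_trichotomy (firstLong ε h) m with h1 | h1 | h1
  · exact absurd (firstLong_spec ⟨m, hm⟩) (not_lt.mpr (hlt _ h1))
  · exact h1
  · exact absurd hm (not_lt.mpr (le_of_lt_firstLong h1))

lemma firstLong_consSeq_of_lt {u : ℝ} (hu : ε < u) (h : ℕ → ℝ) :
    firstLong ε (consSeq (u, h)) = 0 :=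
  firstLong_eq hu (by simp)

lemma firstLong_consSeq_of_le {u : ℝ} (hu : u ≤ ε) {h : ℕ → ℝ} (hh : ∃ k, ε < h k) :
    firstLong ε (consSeq (u, h)) = firstLong ε h + 1 := by
  refine firstLong_eq (firstLong_spec hh) fun k hk => ?_
  cases k with
  | zero => exact hu
  | succ k => exact le_of_lt_firstLong (h := h) (by omega)

lemma lengthOfGaps_consSeq_of_lt {u : ℝ} (hu : ε < u) (h : ℕ → ℝ) :
    lengthOfGaps ε (consSeq (u, h)) = ε := by
  simp [lengthOfGaps, firstLong_consSeq_of_lt hu]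

lemma lengthOfGaps_consSeq_of_le {u : ℝ} (hu : u ≤ ε) {h : ℕ → ℝ} (hh : ∃ k, ε < h k) :
    lengthOfGaps ε (consSeq (u, h)) = u + lengthOfGaps ε h := by
  rw [lengthOfGaps, firstLong_consSeq_of_le hu hh, Finset.sum_range_succ', lengthOfGaps]
  simp only [consSeq]
  ring

lemma gapsAfter_consSeq_of_lt {u : ℝ} (hu : ε < u) (h : ℕ → ℝ) :
    gapsAfter ε (consSeq (u, h)) = consSeq (u - ε, h) := by
  funext k
  cases k <;> simp [gapsAfter, firstLong_consSeq_of_lt hu, consSeq]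

lemma gapsAfter_consSeq_of_le {u : ℝ} (hu : u ≤ ε) {h : ℕ → ℝ} (hh : ∃ k, ε < h k) :
    gapsAfter ε (consSeq (u, h)) = gapsAfter ε h := by
  funext k
  cases k with
  | zero => simp only [gapsAfter, firstLong_consSeq_of_le hu hh, consSeq]
  | succ k =>
    simp only [gapsAfter, firstLong_consSeq_of_le hu hh]
    rw [add_right_comm, consSeq]

end Deterministic

section Measurability

@[fun_prop]
lemma measurable_consSeq : Measurable consSeq := by
  refine measurable_pi_lambda _ fun k => ?_
  cases k with
  | zero => exact measurable_fst
  | succ k => exact (measurable_pi_apply k).comp measurable_snd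

@[fun_prop]
lemma measurable_tailSeq : Measurable tailSeq :=
  measurable_pi_lambda _ fun k => measurable_pi_apply (k + 1)

lemma measurable_firstLong (ε : ℝ) : Measurable (firstLong ε) := by
  have hs : ∀ k, MeasurableSet {h : ℕ → ℝ | ε < h k} := fun k =>
    measurableSet_lt measurable_const (measurable_pi_apply k)
  have hS : MeasurableSet {h : ℕ → ℝ | ∃ k, ε < h k} := by
    simp only [ofPred_exists]
    exact MeasurableSet.iUnion hs
  refine measurable_to_countable' fun m => ?_
  have : firstLong ε ⁻¹' {m} = ({h | ε < h m} ∩ ⋂ k, {h | k < m → ¬ ε < h k}) ∪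
      ({h | m = 0} ∩ {h | ∃ k, ε < h k}ᶜ) := by
    ext h
    simp only [mem_preimage, mem_singleton_iff, mem_union, mem_inter_iff, mem_ofPred_eq, mem_iInter,
      mem_compl_iff, not_lt]
    constructor
    · rintro rfl
      by_cases hh : ∃ k, ε < h k
      · exact Or.inl ⟨firstLong_spec hh, fun k hk => le_of_lt_firstLong hk⟩
      · refine Or.inr ⟨?_, hh⟩
        rw [firstLong, Nat.sInf_eq_zero]
        right
        ext k
        simpa using fun h1 => hh ⟨k, h1⟩
    · rintro (⟨h1, h2⟩ | ⟨rfl, h2⟩)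
      · exact firstLong_eq h1 h2
      · rw [firstLong, Nat.sInf_eq_zero]
        right
        ext k
        simpa using fun h1 => h2 ⟨k, h1⟩
  rw [this]
  refine ((hs m).inter (MeasurableSet.iInter fun k => ?_)).union
    ((MeasurableSet.const _).inter hS.compl)
  by_cases hk : k < m
  · simp only [hk, forall_const]
    exact (hs k).compl
  · simp [hk]

lemma measurable_comp_firstLong (ε : ℝ) {f : ℕ → (ℕ → ℝ) → ℝ} (hf : ∀ m, Measurable (f m)) :
    Measurable fun h => f (firstLong ε h) h :=
  (measurable_from_prod_countable_right (f := fun p : ℕ × (ℕ → ℝ) => f p.1 p.2) hf).comp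
    ((measurable_firstLong ε).prodMk measurable_id)

@[fun_prop]
lemma measurable_lengthOfGaps (ε : ℝ) : Measurable (lengthOfGaps ε) :=
  measurable_comp_firstLong ε (f := fun m h => ∑ k ∈ Finset.range m, h k + ε) fun m => by fun_prop

@[fun_prop]
lemma measurable_gapsAfter (ε : ℝ) : Measurable (gapsAfter ε) := by
  refine measurable_pi_lambda _ fun k => ?_
  cases k with
  | zero => exact measurable_comp_firstLong ε (f := fun m h => h m - ε) fun m => by fun_prop
  | succ k =>
    exact measurable_comp_firstLong ε (f := fun m h => h (m + (k + 1))) fun m => by fun_prop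

end Measurability

/-! ### The law of the gap sequence -/

/-- The law of a sequence of independent exponential variables of parameter `lam`. -/
noncomputable def gapMeasure (lam : ℝ) : Measure (ℕ → ℝ) :=
  Measure.infinitePi fun _ => expMeasure lam

section GapMeasure

variable {lam ε : ℝ}

lemma isProbabilityMeasure_gapMeasure (hlam : 0 < lam) :
    IsProbabilityMeasure (gapMeasure lam) := by
  have := isProbabilityMeasure_expMeasure hlam
  unfold gapMeasure
  infer_instance

lemma measurePreserving_consSeq (hlam : 0 < lam) :
    MeasurePreserving consSeq ((expMeasure lam).prod (gapMeasure lam)) (gapMeasure lam) := by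
  have := isProbabilityMeasure_expMeasure hlam
  have := isProbabilityMeasure_gapMeasure hlam
  refine ⟨measurable_consSeq, Measure.eq_infinitePi _ fun s t ht => ?_⟩
  -- Membership in `s` is turned into a choice of factors, so that the box splits along `consSeq`.
  classical
  set t' : ℕ → Set ℝ := fun i => if i ∈ s then t i else univ with ht'
  have hm' : ∀ i, MeasurableSet (t' i) := fun i => by
    simp only [ht']; split_ifs
    exacts [ht i, MeasurableSet.univ]
  obtain ⟨n, hn⟩ : ∃ n, s ⊆ Finset.range (n + 1) := by
    obtain ⟨n, hn⟩ := s.exists_nat_subset_range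
    exact ⟨n, hn.trans (Finset.range_mono n.le_succ)⟩
  have hbox : (s : Set ℕ).pi t = (Finset.range (n + 1) : Set ℕ).pi t' := by
    ext h
    simp only [Set.mem_pi, Finset.mem_coe, ht']
    constructor
    · intro H i _
      by_cases hi : i ∈ s
      · simpa only [hi, if_true] using H i hi
      · simp only [hi, if_false, mem_univ]
    · intro H i hi
      simpa only [hi, if_true] using H i (hn hi)
  have hprod : ∏ i ∈ s, expMeasure lam (t i) =
      ∏ i ∈ Finset.range (n + 1), expMeasure lam (t' i) := by
    rw [← Finset.prod_subset hn]
    · exact Finset.prod_congr rfl fun i hi => by simp [ht', hi]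
    · intro i _ hi
      simp [ht', hi]
  rw [hbox, hprod, Measure.map_apply measurable_consSeq
    (MeasurableSet.pi (Finset.countable_toSet _) fun i _ => hm' i)]
  have hpre : consSeq ⁻¹' (Finset.range (n + 1) : Set ℕ).pi t' =
      t' 0 ×ˢ (Finset.range n : Set ℕ).pi fun i => t' (i + 1) := by
    ext ⟨u, h⟩
    simp only [mem_preimage, Set.mem_pi, Finset.mem_coe, Finset.mem_range, mem_prod]
    constructor
    · exact fun H => ⟨H 0 (by omega), fun i hi => H (i + 1) (by omega)⟩
    · rintro ⟨h0, H⟩ (_ | i) hi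
      exacts [h0, H i (by omega)]
  rw [hpre, Measure.prod_prod, gapMeasure, Measure.infinitePi_pi _ fun i _ => hm' (i + 1),
    Finset.prod_range_succ' _ n, mul_comm]

lemma measurePreserving_tailSeq (hlam : 0 < lam) :
    MeasurePreserving tailSeq (gapMeasure lam) (gapMeasure lam) := by
  have := isProbabilityMeasure_expMeasure hlam
  have := isProbabilityMeasure_gapMeasure hlam
  refine ⟨measurable_tailSeq, ?_⟩
  conv_lhs => rw [← (measurePreserving_consSeq hlam).map_eq]
  rw [Measure.map_map measurable_tailSeq measurable_consSeq]
  exact measurePreserving_snd.map_eq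

/-- Conditioning on the first gap. -/
lemma gapMeasure_real_eq_integral (hlam : 0 < lam) {S : Set (ℕ → ℝ)} (hS : MeasurableSet S) :
    (gapMeasure lam).real S =
      ∫ u, (gapMeasure lam).real {h | consSeq (u, h) ∈ S} ∂(expMeasure lam) := by
  have := isProbabilityMeasure_expMeasure hlam
  have := isProbabilityMeasure_gapMeasure hlam
  have h1 := (measurePreserving_consSeq hlam).measure_preimage hS.nullMeasurableSet
  rw [measureReal_def, ← h1, Measure.prod_apply (measurable_consSeq hS), ← integral_toReal]
  · rfl
  · exact (measurable_measure_prodMk_left (measurable_consSeq hS)).aemeasurable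
  · exact Eventually.of_forall fun u => measure_lt_top _ _

/-- Conditioning on the first gap, and replacing the first gap by its excess over `ε` if it is
longer than `ε`. -/
lemma gapMeasure_real_eq_add (hlam : 0 < lam) (hε : 0 < ε) {S : Set (ℕ → ℝ)}
    (hS : MeasurableSet S) :
    (gapMeasure lam).real S =
      Real.exp (-(ε * lam)) *
          ∫ u, (gapMeasure lam).real {h | consSeq (u + ε, h) ∈ S} ∂(expMeasure lam)
        + ∫ u in Iic ε, (gapMeasure lam).real {h | consSeq (u, h) ∈ S} ∂(expMeasure lam) := by
  have := isProbabilityMeasure_expMeasure hlam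
  have := isProbabilityMeasure_gapMeasure hlam
  have hint : Integrable (fun u => (gapMeasure lam).real {h | consSeq (u, h) ∈ S})
      (expMeasure lam) := by
    refine Integrable.of_bound
      (measurable_measure_prodMk_left (measurable_consSeq hS)).ennreal_toReal.aestronglyMeasurable 1
      (Eventually.of_forall fun u => ?_)
    rw [Real.norm_of_nonneg measureReal_nonneg]
    exact measureReal_le_one
  rw [gapMeasure_real_eq_integral hlam hS, ← integral_add_compl (measurableSet_Iic (a := ε)) hint,
    compl_Iic, setIntegral_Ioi_expMeasure hlam hε, add_comm]

lemma ae_exists_long (hlam : 0 < lam) (hε : 0 < ε) :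
    ∀ᵐ h ∂(gapMeasure lam), ∃ k, ε < h k := by
  have := isProbabilityMeasure_expMeasure hlam
  have := isProbabilityMeasure_gapMeasure hlam
  have hS : MeasurableSet {h : ℕ → ℝ | ∀ k, h k ≤ ε} := by
    simp only [ofPred_forall]
    exact MeasurableSet.iInter fun k => measurableSet_le (measurable_pi_apply k) measurable_const
  have h1 := gapMeasure_real_eq_add hlam hε hS
  have h2 : ∫ u, (gapMeasure lam).real {h | consSeq (u + ε, h) ∈ {h : ℕ → ℝ | ∀ k, h k ≤ ε}}
      ∂(expMeasure lam) = 0 := by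
    refine integral_eq_zero_of_ae ?_
    filter_upwards [ae_pos_expMeasure hlam] with u hu
    have : {h | consSeq (u + ε, h) ∈ {h : ℕ → ℝ | ∀ k, h k ≤ ε}} = ∅ := by
      ext h
      simp only [mem_ofPred_eq, mem_empty_iff_false, iff_false, not_forall, not_le]
      exact ⟨0, by simpa [consSeq] using hu⟩
    change (gapMeasure lam).real {h | consSeq (u + ε, h) ∈ {h : ℕ → ℝ | ∀ k, h k ≤ ε}} = 0
    rw [this, measureReal_empty]
  have h3 : ∫ u in Iic ε, (gapMeasure lam).real
      {h | consSeq (u, h) ∈ {h : ℕ → ℝ | ∀ k, h k ≤ ε}} ∂(expMeasure lam) =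
      ∫ u in Iic ε, (gapMeasure lam).real {h : ℕ → ℝ | ∀ k, h k ≤ ε} ∂(expMeasure lam) := by
    refine setIntegral_congr_fun measurableSet_Iic fun u (hu : u ≤ ε) => ?_
    congr 1
    ext h
    refine ⟨fun H k => H (k + 1), fun H k => ?_⟩
    cases k with
    | zero => exact hu
    | succ k => exact H k
  rw [h2, h3, setIntegral_const, expMeasure_real_Iic hlam hε.le, smul_eq_mul] at h1
  have h4 : (gapMeasure lam).real {h : ℕ → ℝ | ∀ k, h k ≤ ε} = 0 := by
    have : Real.exp (-(lam * ε)) * (gapMeasure lam).real {h : ℕ → ℝ | ∀ k, h k ≤ ε} = 0 := by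
      linarith
    exact (mul_eq_zero.mp this).resolve_left (Real.exp_pos _).ne'
  rw [ae_iff]
  simp only [not_exists, not_lt]
  exact (measureReal_eq_zero_iff (by finiteness)).mp h4

/-- Gap sequences with positive terms, infinitely many of which exceed `ε`. -/
structure IsRegular (ε : ℝ) (g : ℕ → ℝ) : Prop where
  pos : ∀ k, 0 < g k
  long : ∀ m, ∃ k, ε < g (m + k)

lemma ae_isRegular (hlam : 0 < lam) (hε : 0 < ε) :
    ∀ᵐ g ∂(gapMeasure lam), IsRegular ε g := by
  have := isProbabilityMeasure_expMeasure hlam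
  have h1 : ∀ᵐ g ∂(gapMeasure lam), ∀ k, 0 < g k := by
    rw [ae_all_iff]
    intro k
    have := Measure.infinitePi_map_eval (fun _ : ℕ => expMeasure lam) k
    have h := ae_pos_expMeasure hlam
    rw [← this] at h
    exact ae_of_ae_map (measurable_pi_apply k).aemeasurable h
  have h2 : ∀ᵐ g ∂(gapMeasure lam), ∀ m, ∃ k, ε < g (m + k) := by
    rw [ae_all_iff]
    intro m
    have hmp := (measurePreserving_tailSeq hlam).iterate m
    have h := hmp.quasiMeasurePreserving.ae (ae_exists_long hlam hε)
    have ht : ∀ (m : ℕ) (g : ℕ → ℝ) (k : ℕ), tailSeq^[m] g k = g (m + k) := by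
      intro m
      induction m with
      | zero => simp
      | succ m ih =>
        intro g k
        rw [Function.iterate_succ_apply, ih, tailSeq]
        congr 1; omega
    simpa only [ht] using h
  filter_upwards [h1, h2] with g h1 h2 using ⟨h1, h2⟩

/-- The strong Markov property at the end of a cluster: seen from there, the points form a Poisson
process again. -/
lemma measurePreserving_gapsAfter (hlam : 0 < lam) (hε : 0 < ε) :
    MeasurePreserving (gapsAfter ε) (gapMeasure lam) (gapMeasure lam) := by
  have := isProbabilityMeasure_expMeasure hlam
  have := isProbabilityMeasure_gapMeasure hlam
  refine ⟨measurable_gapsAfter ε, Measure.ext fun A hA => ?_⟩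
  rw [Measure.map_apply (measurable_gapsAfter ε) hA]
  have h1 := gapMeasure_real_eq_add hlam hε (measurable_gapsAfter ε hA)
  have h2 : ∫ u, (gapMeasure lam).real {h | consSeq (u + ε, h) ∈ gapsAfter ε ⁻¹' A}
      ∂(expMeasure lam) = (gapMeasure lam).real A := by
    rw [gapMeasure_real_eq_integral hlam hA]
    refine integral_congr_ae ?_
    filter_upwards [ae_pos_expMeasure hlam] with u hu
    simp only [mem_preimage, gapsAfter_consSeq_of_lt (show ε < u + ε by linarith),
      add_sub_cancel_right]
  have h3 : ∫ u in Iic ε, (gapMeasure lam).real {h | consSeq (u, h) ∈ gapsAfter ε ⁻¹' A}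
      ∂(expMeasure lam) =
      ∫ u in Iic ε, (gapMeasure lam).real (gapsAfter ε ⁻¹' A) ∂(expMeasure lam) := by
    refine setIntegral_congr_fun measurableSet_Iic fun u (hu : u ≤ ε) => ?_
    refine measureReal_congr ?_
    filter_upwards [ae_exists_long hlam hε] with h hh
    exact congrArg (· ∈ A) (gapsAfter_consSeq_of_le hu hh)
  rw [h2, h3, setIntegral_const, expMeasure_real_Iic hlam hε.le, smul_eq_mul, mul_comm ε] at h1
  have h4 : (gapMeasure lam).real (gapsAfter ε ⁻¹' A) = (gapMeasure lam).real A := by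
    have := Real.exp_pos (-(lam * ε))
    have h5 : Real.exp (-(lam * ε)) * (gapMeasure lam).real (gapsAfter ε ⁻¹' A) =
      Real.exp (-(lam * ε)) * (gapMeasure lam).real A := by linarith
    exact mul_left_cancel₀ this.ne' h5
  exact (measureReal_eq_measureReal_iff (by finiteness) (by finiteness)).mp h4

/-! ### Distribution functions -/

/-- The distribution function of a function of the gap sequence. -/
noncomputable def gapCdf (lam : ℝ) (W : (ℕ → ℝ) → ℝ) (x : ℝ) : ℝ :=
  (gapMeasure lam).real {h | W h ≤ x}

lemma monotone_gapCdf (hlam : 0 < lam) (W : (ℕ → ℝ) → ℝ) : Monotone (gapCdf lam W) := by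
  have := isProbabilityMeasure_gapMeasure hlam
  exact fun x y hxy => measureReal_mono fun h (hh : W h ≤ x) => hh.trans hxy

lemma leftBounded_gapCdf (hlam : 0 < lam) (W : (ℕ → ℝ) → ℝ) : LeftBounded (gapCdf lam W) :=
  Monotone.leftBounded (monotone_gapCdf hlam W) fun _ => measureReal_nonneg

lemma gapCdf_zero (hlam : 0 < lam) (c ε x : ℝ) :
    gapCdf lam (fun _ => 0) x = truncPow c ε 0 x := by
  have := isProbabilityMeasure_gapMeasure hlam
  rcases le_or_gt 0 x with h | h
  · simp [gapCdf, truncPow_zero_of_nonneg h, h]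
  · simp [gapCdf, truncPow_zero_of_neg h, not_le.mpr h]

/-- Adding an exponential first gap. -/
lemma gapCdf_head_add_tail (hlam : 0 < lam) {W : (ℕ → ℝ) → ℝ} (hW : Measurable W) (x : ℝ) :
    gapCdf lam (fun g => g 0 + W (tailSeq g)) x =
      ∫ u, gapCdf lam W (x - u) ∂(expMeasure lam) := by
  have hm : MeasurableSet {g : ℕ → ℝ | g 0 + W (tailSeq g) ≤ x} :=
    measurableSet_le (by fun_prop) measurable_const
  rw [gapCdf, gapMeasure_real_eq_integral hlam hm]
  refine integral_congr_ae (Eventually.of_forall fun u => ?_)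
  simp only [gapCdf, mem_ofPred_eq, le_sub_iff_add_le']
  rfl

/-- The renewal equation of the first gap after the beginning of a cluster: either it exceeds `ε`
and ends the cluster, or it moves the beginning of the cluster. -/
lemma gapCdf_lengthOfGaps_add (hlam : 0 < lam) (hε : 0 < ε) {V : (ℕ → ℝ) → ℝ} (hV : Measurable V)
    (x : ℝ) :
    gapCdf lam (fun h => lengthOfGaps ε h + V (gapsAfter ε h)) x =
      Real.exp (-(ε * lam)) * gapCdf lam V (x - ε) +
        ∫ u in Iic ε, gapCdf lam (fun h => lengthOfGaps ε h + V (gapsAfter ε h)) (x - u)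
          ∂(expMeasure lam) := by
  have hm : MeasurableSet {h : ℕ → ℝ | lengthOfGaps ε h + V (gapsAfter ε h) ≤ x} :=
    measurableSet_le (by fun_prop) measurable_const
  have hmV : MeasurableSet {h : ℕ → ℝ | V h ≤ x - ε} := measurableSet_le hV measurable_const
  rw [gapCdf, gapMeasure_real_eq_add hlam hε hm]
  congr 1
  · congr 1
    rw [gapCdf, gapMeasure_real_eq_integral hlam hmV]
    refine integral_congr_ae ?_
    filter_upwards [ae_pos_expMeasure hlam] with u hu
    have : ε < u + ε := by linarith
    simp only [gapsAfter_consSeq_of_lt this, lengthOfGaps_consSeq_of_lt this,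
      add_sub_cancel_right, le_sub_iff_add_le']
  · refine setIntegral_congr_fun measurableSet_Iic fun u (hu : u ≤ ε) => measureReal_congr ?_
    filter_upwards [ae_exists_long hlam hε] with h hh
    refine propext ?_
    change lengthOfGaps ε (consSeq (u, h)) + V (gapsAfter ε (consSeq (u, h))) ≤ x ↔
      lengthOfGaps ε h + V (gapsAfter ε h) ≤ x - u
    rw [gapsAfter_consSeq_of_le hu hh, lengthOfGaps_consSeq_of_le hu hh, le_sub_iff_add_le',
      add_assoc]

end GapMeasure

/-! ### Clusters in terms of the gap sequence -/

/-- The points with a given gap sequence. -/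
def pointsOfGaps (g : ℕ → ℝ) (j : ℕ) : ℝ := ∑ k ∈ Finset.range (j + 1), g k

/-- The index of the first point of each cluster. -/
noncomputable def startIndex (ε : ℝ) (g : ℕ → ℝ) : ℕ → ℕ
  | 0 => 0
  | i + 1 => startIndex ε g i + firstLong ε (fun k => g (startIndex ε g i + 1 + k)) + 1

section Paths

variable {ε : ℝ} {g : ℕ → ℝ}

lemma pointsOfGaps_gap (x : ℕ → ℝ) : pointsOfGaps (gap x) = x := by
  funext j
  induction j with
  | zero => simp [pointsOfGaps, gap]
  | succ j ih =>
    rw [pointsOfGaps, Finset.sum_range_succ]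
    rw [pointsOfGaps] at ih
    rw [ih, gap]; ring

lemma pointsOfGaps_succ (g : ℕ → ℝ) (j : ℕ) :
    pointsOfGaps g (j + 1) = pointsOfGaps g j + g (j + 1) := by
  rw [pointsOfGaps, Finset.sum_range_succ, pointsOfGaps]

lemma pointsOfGaps_succ_sub (g : ℕ → ℝ) (j : ℕ) :
    pointsOfGaps g (j + 1) - pointsOfGaps g j = g (j + 1) := by
  rw [pointsOfGaps_succ]; ring

lemma IsRegular.strictMono_pointsOfGaps (hg : IsRegular ε g) : StrictMono (pointsOfGaps g) :=
  strictMono_nat_of_lt_succ fun j => by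
    have := hg.pos (j + 1)
    have := pointsOfGaps_succ_sub g j
    linarith

lemma csInf_setOf_eq_of_monotone {f : ℕ → ℝ} (hf : Monotone f) {p : ℕ → Prop} {m : ℕ} (hm : p m)
    (hmin : ∀ j, p j → m ≤ j) : sInf {y | ∃ j, y = f j ∧ p j} = f m :=
  IsLeast.csInf_eq ⟨⟨m, rfl, hm⟩, by rintro _ ⟨j, rfl, hj⟩; exact hf (hmin j hj)⟩

lemma add_firstLong_le {m j : ℕ} (hmj : m ≤ j)
    (hj : ε < g (j + 1)) : m + firstLong ε (fun k => g (m + 1 + k)) ≤ j := by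
  by_contra! h
  have := le_of_lt_firstLong (ε := ε) (h := fun k => g (m + 1 + k)) (k := j - m) (by omega)
  have h2 : m + 1 + (j - m) = j + 1 := by omega
  simp only [h2] at this
  exact absurd hj (not_lt.mpr this)

lemma IsRegular.long_firstLong (hg : IsRegular ε g) (m : ℕ) :
    ε < g (m + firstLong ε (fun k => g (m + 1 + k)) + 1) := by
  have := firstLong_spec (h := fun k => g (m + 1 + k)) (hg.long (m + 1))
  rwa [add_right_comm] at this

lemma clusterStart_eq (hg : IsRegular ε g) (i : ℕ) :
    clusterStart ε (pointsOfGaps g) i = pointsOfGaps g (startIndex ε g i) := by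
  have hmono := hg.strictMono_pointsOfGaps
  induction i with
  | zero => rfl
  | succ i ih =>
    rw [clusterStart, ih, startIndex]
    refine csInf_setOf_eq_of_monotone (f := fun j => pointsOfGaps g (j + 1))
      (fun a b hab => hmono.monotone (by omega)) ⟨hmono (by omega), ?_⟩ ?_
    · rw [pointsOfGaps_succ_sub]
      exact hg.long_firstLong _
    · rintro j ⟨h1, h2⟩
      rw [pointsOfGaps_succ_sub] at h2
      have := hmono.lt_iff_lt.mp h1
      exact add_firstLong_le (by omega) h2

lemma clusterEnd_eq (hg : IsRegular ε g) (i : ℕ) :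
    clusterEnd ε (pointsOfGaps g) i =
      pointsOfGaps g (startIndex ε g i + firstLong ε (fun k => g (startIndex ε g i + 1 + k)))
        + ε := by
  have hmono := hg.strictMono_pointsOfGaps
  rw [clusterEnd, clusterStart_eq hg]
  refine csInf_setOf_eq_of_monotone (f := fun j => pointsOfGaps g j + ε)
    (fun a b hab => by simpa using hmono.monotone hab) ⟨hmono.monotone (by omega), ?_⟩ ?_
  · rw [pointsOfGaps_succ_sub]
    exact hg.long_firstLong _
  · rintro j ⟨h1, h2⟩
    rw [pointsOfGaps_succ_sub] at h2
    exact add_firstLong_le (hmono.le_iff_le.mp h1) h2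

lemma isRegular_gapsAfter (hg : IsRegular ε g) :
    IsRegular ε (gapsAfter ε (tailSeq g)) := by
  have h0 := firstLong_spec (h := tailSeq g) (by simpa [tailSeq, add_comm] using hg.long 1)
  refine ⟨fun k => ?_, fun m => ?_⟩
  · cases k with
    | zero => simpa [gapsAfter] using h0
    | succ k => exact hg.pos _
  · obtain ⟨k, hk⟩ := hg.long (firstLong ε (tailSeq g) + (m + 1) + 1)
    refine ⟨k + 1, ?_⟩
    rw [← add_assoc, gapsAfter, tailSeq]
    convert! hk using 2
    omega

lemma gapsAfter_tailSeq_succ (g : ℕ → ℝ) (m k : ℕ) :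
    gapsAfter ε (tailSeq g) (m + 1 + k) = g (firstLong ε (tailSeq g) + 1 + m + 1 + k) := by
  rw [add_right_comm, gapsAfter, tailSeq]
  congr 1; omega

lemma startIndex_succ' (g : ℕ → ℝ) (i : ℕ) :
    startIndex ε g (i + 1) =
      firstLong ε (tailSeq g) + 1 + startIndex ε (gapsAfter ε (tailSeq g)) i := by
  induction i with
  | zero =>
    simp only [startIndex]
    have : (fun k => g (0 + 1 + k)) = tailSeq g := by
      funext k; rw [tailSeq]; congr 1; omega
    rw [this]; omega
  | succ i ih =>
    rw [startIndex, ih, startIndex]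
    simp only [gapsAfter_tailSeq_succ]
    omega

lemma pointsOfGaps_firstLong (ε : ℝ) (g : ℕ → ℝ) :
    pointsOfGaps g (firstLong ε (tailSeq g)) + ε = g 0 + lengthOfGaps ε (tailSeq g) := by
  rw [pointsOfGaps, Finset.sum_range_succ', lengthOfGaps]
  simp only [tailSeq]
  ring

/-- The points seen from the end of the first cluster. -/
lemma pointsOfGaps_gapsAfter (ε : ℝ) (g : ℕ → ℝ) (j : ℕ) :
    pointsOfGaps g (firstLong ε (tailSeq g) + 1 + j) =
      g 0 + lengthOfGaps ε (tailSeq g) + pointsOfGaps (gapsAfter ε (tailSeq g)) j := by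
  induction j with
  | zero =>
    rw [add_zero, pointsOfGaps_succ, ← pointsOfGaps_firstLong]
    simp [pointsOfGaps, gapsAfter, tailSeq]
  | succ j ih =>
    rw [← add_assoc, pointsOfGaps_succ, ih, pointsOfGaps_succ]
    have := gapsAfter_tailSeq_succ (ε := ε) g j 0
    simp only [add_zero] at this
    rw [this]; ring_nf

lemma clusterStart_succ (hg : IsRegular ε g) (i : ℕ) :
    clusterStart ε (pointsOfGaps g) (i + 1) = g 0 + lengthOfGaps ε (tailSeq g) +
      clusterStart ε (pointsOfGaps (gapsAfter ε (tailSeq g))) i := by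
  rw [clusterStart_eq hg, clusterStart_eq (isRegular_gapsAfter hg), startIndex_succ',
    pointsOfGaps_gapsAfter]

lemma clusterEnd_zero (hg : IsRegular ε g) :
    clusterEnd ε (pointsOfGaps g) 0 = g 0 + lengthOfGaps ε (tailSeq g) := by
  rw [clusterEnd_eq hg, ← pointsOfGaps_firstLong]
  have : (fun k => g (0 + 1 + k)) = tailSeq g := by
    funext k; rw [tailSeq]; congr 1; omega
  simp [startIndex, this]

lemma clusterEnd_succ (hg : IsRegular ε g) (i : ℕ) :
    clusterEnd ε (pointsOfGaps g) (i + 1) = g 0 + lengthOfGaps ε (tailSeq g) +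
      clusterEnd ε (pointsOfGaps (gapsAfter ε (tailSeq g))) i := by
  rw [clusterEnd_eq hg, clusterEnd_eq (isRegular_gapsAfter hg), startIndex_succ',
    ← add_assoc (g 0 + _), ← pointsOfGaps_gapsAfter]
  simp only [gapsAfter_tailSeq_succ]
  congr 2
  omega

lemma IsRegular.lengthOfGaps_pos (hε : 0 < ε) (hg : IsRegular ε g) :
    0 < lengthOfGaps ε (tailSeq g) :=
  add_pos_of_nonneg_of_pos (Finset.sum_nonneg fun k _ => (hg.pos (k + 1)).le) hε

lemma clusterStart_nonneg (hg : IsRegular ε g) (i : ℕ) :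
    0 ≤ clusterStart ε (pointsOfGaps g) i := by
  rw [clusterStart_eq hg]
  exact Finset.sum_nonneg fun k _ => (hg.pos k).le

lemma monotone_clusterEnd (hε : 0 < ε) (hg : IsRegular ε g) :
    Monotone (clusterEnd ε (pointsOfGaps g)) := by
  refine monotone_nat_of_le_succ fun i => ?_
  induction i generalizing g with
  | zero =>
    have hg' := isRegular_gapsAfter hg
    rw [clusterEnd_succ hg, clusterEnd_zero hg, clusterEnd_zero hg']
    have := hg'.pos 0
    have := hg'.lengthOfGaps_pos hε
    linarith
  | succ i ih =>
    rw [clusterEnd_succ hg, clusterEnd_succ hg]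
    have := ih (isRegular_gapsAfter hg)
    linarith

lemma completeClusters_eq_iff (hε : 0 < ε) (hg : IsRegular ε g) (t : ℝ) (n : ℕ) :
    completeClusters ε (pointsOfGaps g) t = (n : ℕ∞) ↔
      (∀ i < n, clusterEnd ε (pointsOfGaps g) i ≤ t) ∧ t < clusterEnd ε (pointsOfGaps g) n := by
  have hset : {i : ℕ | 0 ≤ clusterStart ε (pointsOfGaps g) i ∧ clusterEnd ε (pointsOfGaps g) i ≤ t}
      = {i | clusterEnd ε (pointsOfGaps g) i ≤ t} := by
    ext i; simp [clusterStart_nonneg hg i]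
  have hmono := monotone_clusterEnd hε hg
  rw [completeClusters, hset]
  constructor
  · intro h
    -- If the `i`-th cluster is incomplete, then at most `i` clusters are complete.
    have h1 : ∀ i, t < clusterEnd ε (pointsOfGaps g) i → n ≤ i := by
      intro i hi
      have hsub : {i | clusterEnd ε (pointsOfGaps g) i ≤ t} ⊆ Iio i := fun j hj => by
        by_contra hji
        exact absurd (hmono (not_lt.mp hji)) (not_le.mpr (lt_of_le_of_lt hj hi))
      have := encard_le_encard hsub
      rw [h] at this
      have h2 : (Iio i).encard = (i : ℕ∞) := by
        rw [← Finset.coe_Iio, encard_coe_eq_coe_finsetCard, Nat.card_Iio]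
      rw [h2] at this
      exact_mod_cast this
    refine ⟨fun i hi => ?_, ?_⟩
    · by_contra h2
      exact absurd (h1 i (not_le.mp h2)) (not_le.mpr hi)
    · by_contra h2
      have hsub : Iic n ⊆ {i | clusterEnd ε (pointsOfGaps g) i ≤ t} := fun j hj =>
        (hmono hj).trans (not_lt.mp h2)
      have := encard_le_encard hsub
      have h3 : (Iic n).encard = ((n + 1 : ℕ) : ℕ∞) := by
        rw [← Finset.coe_Iic, encard_coe_eq_coe_finsetCard, Nat.card_Iic]
      rw [h, h3] at this
      have : n + 1 ≤ n := by exact_mod_cast this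
      omega
  · rintro ⟨h1, h2⟩
    have : {i | clusterEnd ε (pointsOfGaps g) i ≤ t} = Iio n := by
      ext i
      refine ⟨fun hi => ?_, fun hi => h1 i hi⟩
      by_contra hin
      exact absurd (hmono (not_lt.mp hin)) (not_le.mpr (lt_of_le_of_lt hi h2))
    rw [this, ← Finset.coe_Iio, encard_coe_eq_coe_finsetCard, Nat.card_Iio]

end Paths

/-! ### The distribution functions of the ends and of the beginnings of clusters -/

/-- The recursive expression of the beginnings of clusters in terms of the gap sequence, which is
measurable and agrees with `clusterStart` on regular sequences. -/
noncomputable def startOfGaps (ε : ℝ) : ℕ → (ℕ → ℝ) → ℝ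
  | 0, g => g 0
  | i + 1, g =>
    g 0 + (lengthOfGaps ε (tailSeq g) + startOfGaps ε i (gapsAfter ε (tailSeq g)))

/-- The recursive expression of the ends of clusters in terms of the gap sequence, which is
measurable and agrees with `clusterEnd` on regular sequences. -/
noncomputable def endOfGaps (ε : ℝ) : ℕ → (ℕ → ℝ) → ℝ
  | 0, g => g 0 + (lengthOfGaps ε (tailSeq g) + 0)
  | i + 1, g =>
    g 0 + (lengthOfGaps ε (tailSeq g) + endOfGaps ε i (gapsAfter ε (tailSeq g)))

section Cdf

variable {lam ε : ℝ}

@[fun_prop]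
lemma measurable_startOfGaps (ε : ℝ) (i : ℕ) : Measurable (startOfGaps ε i) := by
  induction i with
  | zero => exact measurable_pi_apply 0
  | succ i ih =>
    change Measurable fun g : ℕ → ℝ =>
      g 0 + (lengthOfGaps ε (tailSeq g) + startOfGaps ε i (gapsAfter ε (tailSeq g)))
    fun_prop

@[fun_prop]
lemma measurable_endOfGaps (ε : ℝ) (i : ℕ) : Measurable (endOfGaps ε i) := by
  induction i with
  | zero =>
    change Measurable fun g : ℕ → ℝ => g 0 + (lengthOfGaps ε (tailSeq g) + 0)
    fun_prop
  | succ i ih =>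
    change Measurable fun g : ℕ → ℝ =>
      g 0 + (lengthOfGaps ε (tailSeq g) + endOfGaps ε i (gapsAfter ε (tailSeq g)))
    fun_prop

lemma clusterStart_eq_startOfGaps {g : ℕ → ℝ} (hg : IsRegular ε g) (i : ℕ) :
    clusterStart ε (pointsOfGaps g) i = startOfGaps ε i g := by
  induction i generalizing g with
  | zero => simp [clusterStart, startOfGaps, pointsOfGaps]
  | succ i ih =>
    rw [clusterStart_succ hg, ih (isRegular_gapsAfter hg), startOfGaps, add_assoc]

lemma clusterEnd_eq_endOfGaps {g : ℕ → ℝ} (hg : IsRegular ε g) (i : ℕ) :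
    clusterEnd ε (pointsOfGaps g) i = endOfGaps ε i g := by
  induction i generalizing g with
  | zero => rw [clusterEnd_zero hg, endOfGaps, add_zero]
  | succ i ih =>
    rw [clusterEnd_succ hg, ih (isRegular_gapsAfter hg), endOfGaps, add_assoc]

lemma clusterLength_eq {g : ℕ → ℝ} (hg : IsRegular ε g) (i : ℕ) :
    clusterLength ε (pointsOfGaps g) i =
      lengthOfGaps ε (tailSeq ((gapsAfter ε ∘ tailSeq)^[i] g)) := by
  induction i generalizing g with
  | zero =>
    rw [clusterLength, clusterEnd_zero hg]
    simp [clusterStart, pointsOfGaps]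
  | succ i ih =>
    have := ih (isRegular_gapsAfter hg)
    rw [clusterLength] at this
    rw [clusterLength, clusterEnd_succ hg, clusterStart_succ hg, add_sub_add_left_eq_sub,
      this, Function.iterate_succ_apply, Function.comp_apply]

lemma cycleSum_eq (ε : ℝ) (x : ℕ → ℝ) (n : ℕ) :
    cycleSum ε x n = clusterStart ε x n - clusterStart ε x 0 :=
  Finset.sum_range_sub (clusterStart ε x) n

lemma cycleSum_succ_eq {g : ℕ → ℝ} (hg : IsRegular ε g) (n : ℕ) :
    cycleSum ε (pointsOfGaps g) (n + 1) =
      lengthOfGaps ε (tailSeq g) + startOfGaps ε n (gapsAfter ε (tailSeq g)) := by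
  rw [cycleSum_eq, clusterStart_eq_startOfGaps hg, clusterStart_eq_startOfGaps hg,
    startOfGaps, startOfGaps]
  ring

/-- If `V` has the distribution function of the end of the `(n-1)`-st cluster (of `0` if `n = 0`),
then the length of a cluster plus the value of `V` after the cluster has the distribution function
`renewalSum`. -/
lemma gapCdf_eq_renewalSum (hlam : 0 < lam) (hε : 0 < ε) {V : (ℕ → ℝ) → ℝ} (hV : Measurable V)
    {N n : ℕ}
    (h : ∀ x < N * ε, gapCdf lam V x = probSum (lam * Real.exp (-(ε * lam))) ε N n x
      + cdfSum (lam * Real.exp (-(ε * lam))) ε N n x) {x : ℝ} (hx : x ≤ N * ε) :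
    gapCdf lam (fun h => lengthOfGaps ε h + V (gapsAfter ε h)) x = renewalSum lam ε N n x := by
  refine eqOn_of_renewal hlam hε (leftBounded_gapCdf hlam _) (LeftBounded.renewalSum hlam ε N n)
    (fun x _ => gapCdf_lengthOfGaps_add hlam hε hV x) (fun x hx => ?_) hx
  rw [setIntegral_renewalSum hlam N n x hε.le, h (x - ε) (by linarith), renewalSum,
    mul_comm lam ε]
  ring

lemma gapCdf_head_add_eq_cdfSum (hlam : 0 < lam) (hε : 0 < ε) {V : (ℕ → ℝ) → ℝ}
    (hV : Measurable V) {N n : ℕ}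
    (h : ∀ x < N * ε, gapCdf lam V x = probSum (lam * Real.exp (-(ε * lam))) ε N n x
      + cdfSum (lam * Real.exp (-(ε * lam))) ε N n x) {x : ℝ} (hx : x ≤ N * ε) :
    gapCdf lam (fun g => g 0 + (lengthOfGaps ε (tailSeq g) + V (gapsAfter ε (tailSeq g)))) x =
      cdfSum (lam * Real.exp (-(ε * lam))) ε N n x := by
  rw [gapCdf_head_add_tail hlam (W := fun h => lengthOfGaps ε h + V (gapsAfter ε h))
    (by fun_prop), ← integral_renewalSum hlam hε N n x]
  refine integral_congr_ae ?_
  filter_upwards [ae_pos_expMeasure hlam] with u hu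
  exact gapCdf_eq_renewalSum hlam hε hV h (by linarith)

lemma gapCdf_zero_eq (hlam : 0 < lam) (hε : 0 < ε) (c : ℝ) {N : ℕ} {x : ℝ} (hx : x < N * ε) :
    gapCdf lam (fun _ => 0) x = probSum c ε N 0 x + cdfSum c ε N 0 x := by
  rw [gapCdf_zero hlam c ε, ← probSum_zero_add_cdfSum N x, probSum_eq_of_lt hε 0 N.le_succ hx]

lemma gapCdf_endOfGaps (hlam : 0 < lam) (hε : 0 < ε) (N n : ℕ) {x : ℝ} (hx : x ≤ N * ε) :
    gapCdf lam (endOfGaps ε n) x = cdfSum (lam * Real.exp (-(ε * lam))) ε N n x := by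
  induction n generalizing x with
  | zero =>
    exact gapCdf_head_add_eq_cdfSum hlam hε measurable_const
      (fun x hx => gapCdf_zero_eq hlam hε _ hx) hx
  | succ n ih =>
    refine gapCdf_head_add_eq_cdfSum hlam hε (measurable_endOfGaps ε n) (fun x hx => ?_) hx
    rw [ih hx.le, ← probSum_succ_add_cdfSum, probSum_eq_of_lt hε _ N.le_succ hx]

lemma gapCdf_lengthOfGaps (hlam : 0 < lam) (hε : 0 < ε) (N : ℕ) {x : ℝ} (hx : x ≤ N * ε) :
    gapCdf lam (lengthOfGaps ε) x = renewalSum lam ε N 0 x := by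
  simpa using gapCdf_eq_renewalSum hlam hε (V := fun _ => 0) measurable_const
      (fun x hx => gapCdf_zero_eq hlam hε _ hx) hx

/-- The counterpart of `gapCdf_head_add_eq_cdfSum` in which the exponential variable is added to
`V` and not to the length of the cluster. -/
lemma gapCdf_lengthOfGaps_add_eq_cdfSum (hlam : 0 < lam) (hε : 0 < ε) {V : (ℕ → ℝ) → ℝ}
    (hV : Measurable V) {N n : ℕ}
    (h : ∀ x < N * ε, gapCdf lam V x =
      ∫ u, (probSum (lam * Real.exp (-(ε * lam))) ε N n (x - u)
        + cdfSum (lam * Real.exp (-(ε * lam))) ε N n (x - u)) ∂(expMeasure lam))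
    {x : ℝ} (hx : x ≤ N * ε) :
    gapCdf lam (fun h => lengthOfGaps ε h + V (gapsAfter ε h)) x =
      cdfSum (lam * Real.exp (-(ε * lam))) ε N n x := by
  have hc : 0 ≤ lam * Real.exp (-(ε * lam)) := by positivity
  have hP := LeftBounded.probSum ε hc N n
  have hF := LeftBounded.cdfSum ε hc N n
  -- Expressing the integral over `[0, ε]` through the whole law turns the renewal equation of
  -- `cdfSum` into `integral_renewalSum`.
  refine eqOn_of_renewal hlam hε (leftBounded_gapCdf hlam _) hF
    (fun x _ => gapCdf_lengthOfGaps_add hlam hε hV x) (fun x hx => ?_) hx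
  have h1 := integral_renewalSum hlam hε N n x
  simp only [renewalSum] at h1
  rw [integral_add (hF.integrable hlam x) (((hP.comp_sub ε).const_mul _).integrable hlam x),
    integral_const_mul] at h1
  simp only [sub_right_comm x _ ε] at h1
  rw [h (x - ε) (by linarith), setIntegral_Iic_eq_sub hlam hε hF,
    integral_add (hP.integrable hlam _) (hF.integrable hlam _)]
  linarith

lemma gapCdf_cycleSum (hlam : 0 < lam) (hε : 0 < ε) (N n : ℕ) {x : ℝ} (hx : x ≤ N * ε) :
    gapCdf lam (fun h => lengthOfGaps ε h + startOfGaps ε n (gapsAfter ε h)) x =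
      cdfSum (lam * Real.exp (-(ε * lam))) ε N n x := by
  induction n generalizing x with
  | zero =>
    refine gapCdf_lengthOfGaps_add_eq_cdfSum hlam hε (measurable_startOfGaps ε 0)
      (fun x hx => ?_) hx
    have h0 : startOfGaps ε 0 = fun g => g 0 + (fun _ => (0 : ℝ)) (tailSeq g) := by
      funext g; simp [startOfGaps]
    rw [h0, gapCdf_head_add_tail hlam measurable_const]
    refine integral_congr_ae ?_
    filter_upwards [ae_pos_expMeasure hlam] with u hu
    exact gapCdf_zero_eq hlam hε _ (by linarith)
  | succ n ih =>
    refine gapCdf_lengthOfGaps_add_eq_cdfSum hlam hε (measurable_startOfGaps ε (n + 1))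
      (fun x hx => ?_) hx
    have h0 : startOfGaps ε (n + 1) = fun g => g 0 +
        (fun h => lengthOfGaps ε h + startOfGaps ε n (gapsAfter ε h)) (tailSeq g) := by
      funext g; simp [startOfGaps]
    rw [h0, gapCdf_head_add_tail hlam
      (W := fun h => lengthOfGaps ε h + startOfGaps ε n (gapsAfter ε h)) (by fun_prop)]
    refine integral_congr_ae ?_
    filter_upwards [ae_pos_expMeasure hlam] with u hu
    have hxu : x - u < N * ε := by linarith
    rw [ih hxu.le, ← probSum_succ_add_cdfSum, probSum_eq_of_lt hε _ N.le_succ hxu]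

end Cdf

/-! ### The number of complete clusters -/

section Probability

variable {Ω : Type*} [MeasurableSpace Ω] {P : Measure Ω} [IsProbabilityMeasure P] {lam ε : ℝ}
  {X : ℕ → Ω → ℝ}

lemma IsPoissonProcess.measurePreserving_gap (hX : IsPoissonProcess P lam X) :
    MeasurePreserving (fun ω => gap (fun j => X j ω)) P (gapMeasure lam) := by
  have hm : ∀ j, Measurable fun ω => gap (fun k => X k ω) j := by
    intro j
    cases j with
    | zero => exact hX.measurable 0
    | succ j => exact (hX.measurable (j + 1)).sub (hX.measurable j)
  refine ⟨measurable_pi_lambda _ hm, ?_⟩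
  rw [(iIndepFun_iff_map_fun_eq_infinitePi_map hm).mp hX.indep, gapMeasure]
  congr 1
  funext j
  exact (hX.law j).map_eq

lemma IsPoissonProcess.ae_isRegular (hlam : 0 < lam) (hε : 0 < ε) (hX : IsPoissonProcess P lam X) :
    ∀ᵐ ω ∂P, IsRegular ε (gap fun j => X j ω) :=
  hX.measurePreserving_gap.quasiMeasurePreserving.ae (SensorClusters.ae_isRegular hlam hε)

lemma clusterProb_eq_gapMeasure_real (hlam : 0 < lam) (hε : 0 < ε) (hX : IsPoissonProcess P lam X)
    (n : ℕ) (t : ℝ) :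
    clusterProb P X ε n t =
      (gapMeasure lam).real {g | (∀ i < n, endOfGaps ε i g ≤ t) ∧ t < endOfGaps ε n g} := by
  have hS : MeasurableSet {g | (∀ i < n, endOfGaps ε i g ≤ t) ∧ t < endOfGaps ε n g} := by
    have h1 : MeasurableSet {g | ∀ i < n, endOfGaps ε i g ≤ t} := by
      simp only [ofPred_forall]
      exact MeasurableSet.iInter fun i => MeasurableSet.iInter fun _ =>
        measurableSet_le (measurable_endOfGaps ε i) measurable_const
    exact h1.inter (measurableSet_lt measurable_const (measurable_endOfGaps ε n))
  rw [← hX.measurePreserving_gap.measureReal_preimage hS.nullMeasurableSet, clusterProb]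
  refine measureReal_congr ?_
  filter_upwards [hX.ae_isRegular hlam hε] with ω hω
  refine propext ?_
  have := completeClusters_eq_iff hε hω t n
  simp only [clusterEnd_eq_endOfGaps hω] at this
  rw [pointsOfGaps_gap] at this
  exact this

lemma clusterProb_zero_eq (hlam : 0 < lam) (hε : 0 < ε) (hX : IsPoissonProcess P lam X)
    (t : ℝ) : clusterProb P X ε 0 t = 1 - gapCdf lam (endOfGaps ε 0) t := by
  have := isProbabilityMeasure_gapMeasure hlam
  have hm : MeasurableSet {g | endOfGaps ε 0 g ≤ t} :=
    measurableSet_le (measurable_endOfGaps ε 0) measurable_const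
  rw [clusterProb_eq_gapMeasure_real hlam hε hX, gapCdf, ← probReal_compl_eq_one_sub hm]
  congr 1
  ext g
  simp

lemma clusterProb_succ_eq (hlam : 0 < lam) (hε : 0 < ε) (hX : IsPoissonProcess P lam X)
    (n : ℕ) (t : ℝ) :
    clusterProb P X ε (n + 1) t =
      gapCdf lam (endOfGaps ε n) t - gapCdf lam (endOfGaps ε (n + 1)) t := by
  have := isProbabilityMeasure_gapMeasure hlam
  have hm : MeasurableSet {g | endOfGaps ε (n + 1) g ≤ t} :=
    measurableSet_le (measurable_endOfGaps ε (n + 1)) measurable_const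
  have hreg := SensorClusters.ae_isRegular hlam hε
  have h1 := measureReal_sdiff_add_inter (μ := gapMeasure lam) (s := {g | endOfGaps ε n g ≤ t}) hm
  have h2 : (gapMeasure lam).real ({g | endOfGaps ε n g ≤ t} ∩ {g | endOfGaps ε (n + 1) g ≤ t}) =
      (gapMeasure lam).real {g | endOfGaps ε (n + 1) g ≤ t} := by
    refine measureReal_congr ?_
    filter_upwards [hreg] with g hg
    refine propext ⟨fun h => h.2, fun h => ⟨?_, h⟩⟩
    have hle := monotone_clusterEnd hε hg n.le_succ
    rw [clusterEnd_eq_endOfGaps hg, clusterEnd_eq_endOfGaps hg] at hle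
    exact hle.trans h
  have h3 : (gapMeasure lam).real ({g | endOfGaps ε n g ≤ t} \ {g | endOfGaps ε (n + 1) g ≤ t}) =
      clusterProb P X ε (n + 1) t := by
    rw [clusterProb_eq_gapMeasure_real hlam hε hX]
    refine measureReal_congr ?_
    filter_upwards [hreg] with g hg
    refine propext ⟨fun h => ⟨fun i hi => ?_, not_le.mp h.2⟩,
      fun h => ⟨h.1 n n.lt_succ_self, not_le.mpr h.2⟩⟩
    have hle := monotone_clusterEnd hε hg (Nat.lt_succ_iff.mp hi)
    rw [clusterEnd_eq_endOfGaps hg, clusterEnd_eq_endOfGaps hg] at hle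
    exact hle.trans h.1
  rw [gapCdf, gapCdf, ← h3]
  linarith

lemma clusterProb_zero_eq_one_sub (hlam : 0 < lam) (hε : 0 < ε) (hX : IsPoissonProcess P lam X)
    {N : ℕ} {t : ℝ} (htN : t ≤ N * ε) :
    clusterProb P X ε 0 t = 1 - cdfSum (lam * Real.exp (-(ε * lam))) ε N 0 t := by
  rw [clusterProb_zero_eq hlam hε hX, gapCdf_endOfGaps hlam hε N 0 htN]

lemma clusterProb_eq_probSum (hlam : 0 < lam) (hε : 0 < ε) (hX : IsPoissonProcess P lam X)
    {N : ℕ} (n : ℕ) {t : ℝ} (ht : 0 ≤ t) (htN : t < N * ε) :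
    clusterProb P X ε n t = probSum (lam * Real.exp (-(ε * lam))) ε N n t := by
  rw [← probSum_eq_of_lt hε n N.le_succ htN]
  cases n with
  | zero =>
    rw [clusterProb_zero_eq_one_sub hlam hε hX htN.le,
      ← truncPow_zero_of_nonneg (c := lam * Real.exp (-(ε * lam))) (ε := ε) ht,
      ← probSum_zero_add_cdfSum N, add_sub_cancel_right]
  | succ n =>
    rw [clusterProb_succ_eq hlam hε hX, gapCdf_endOfGaps hlam hε N _ htN.le,
      gapCdf_endOfGaps hlam hε N _ htN.le, ← probSum_succ_add_cdfSum, add_sub_cancel_right]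

lemma exists_lt_natCast_mul (hε : 0 < ε) (x : ℝ) : ∃ N : ℕ, x < N * ε := by
  obtain ⟨N, hN⟩ := exists_nat_gt (x / ε)
  exact ⟨N, (div_lt_iff₀ hε).mp hN⟩

lemma hasDerivAt_clusterProb_zero (hlam : 0 < lam) (hε : 0 < ε) (hX : IsPoissonProcess P lam X)
    {N : ℕ} {t : ℝ} (htε : t ≠ ε) (htN : t < N * ε) :
    HasDerivAt (clusterProb P X ε 0)
      (-(lam * Real.exp (-(ε * lam)) * probSum (lam * Real.exp (-(ε * lam))) ε N 0 (t - ε))) t := by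
  refine ((hasDerivAt_cdfSum (c := lam * Real.exp (-(ε * lam))) N 0 htε).const_sub
    1).congr_of_eventuallyEq ?_
  filter_upwards [gt_mem_nhds htN] with y hyN
  exact clusterProb_zero_eq_one_sub hlam hε hX hyN.le

/-- At `ε` the function `p₀` is constant to the left, so that its derivative there can only be `0`,
be it a genuine value or the default one. -/
lemma deriv_clusterProb_zero_self (hlam : 0 < lam) (hε : 0 < ε) (hX : IsPoissonProcess P lam X) :
    deriv (clusterProb P X ε 0) ε = 0 := by
  by_cases hd : DifferentiableAt ℝ (clusterProb P X ε 0) ε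
  · have h1 : ∀ y ≤ ε, clusterProb P X ε 0 y = 1 := fun y hy => by
      rw [clusterProb_zero_eq_one_sub (N := 1) hlam hε hX (by simpa using hy),
        cdfSum_of_le hε _ _ hy, sub_zero]
    have h2 : HasDerivWithinAt (clusterProb P X ε 0) 0 (Iic ε) ε :=
      (hasDerivWithinAt_const ε (Iic ε) (1 : ℝ)).congr h1 (h1 ε le_rfl)
    exact (uniqueDiffWithinAt_Iic ε).eq_deriv _ hd.hasDerivAt.hasDerivWithinAt h2
  · exact deriv_zero_of_not_differentiableAt hd

/-! ### Densities -/

lemma lintegral_Ioc_of_hasDerivAt {F f : ℝ → ℝ} {a b : ℝ} (hab : a ≤ b) {s : Set ℝ}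
    (hs : s.Countable) (hF : Continuous F) (hd : ∀ y ∉ s, HasDerivAt F (f y) y)
    (hint : IntervalIntegrable f volume a b) (hf : ∀ y ∈ Ioc a b, y ∉ s → 0 ≤ f y) :
    ∫⁻ y in Ioc a b, ENNReal.ofReal (f y) = ENNReal.ofReal (F b - F a) := by
  rw [← integral_eq_of_hasDerivAt_off_countable F f hs hF.continuousOn
    (fun y hy => hd y hy.2) hint, intervalIntegral.integral_of_le hab,
    ofReal_integral_eq_lintegral_ofReal]
  · exact (intervalIntegrable_iff_integrableOn_Ioc_of_le hab).mp hint
  · filter_upwards [ae_restrict_mem measurableSet_Ioc, ae_restrict_of_ae (hs.ae_notMem volume)]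
      with y hy hys using hf y hy hys

lemma withDensity_indicator_Iic (d : ℝ → ℝ) (a x : ℝ) :
    volume.withDensity (fun y => ENNReal.ofReal ((Ioi a).indicator d y)) (Iic x) =
      ∫⁻ y in Ioc a x, ENNReal.ofReal (d y) := by
  have : (fun y => ENNReal.ofReal ((Ioi a).indicator d y)) =
      (Ioi a).indicator fun y => ENNReal.ofReal (d y) := by
    funext y
    by_cases hy : y ∈ Ioi a <;> simp [hy]
  rw [withDensity_apply _ measurableSet_Iic, this, lintegral_indicator measurableSet_Ioi,
    Measure.restrict_restrict measurableSet_Ioi, Ioi_inter_Iic]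

lemma hasLaw_of_gapCdf (hlam : 0 < lam) (hX : IsPoissonProcess P lam X) {W : (ℕ → ℝ) → ℝ}
    (hW : Measurable W) {Y : Ω → ℝ} (hY : Y =ᵐ[P] fun ω => W (gap fun j => X j ω))
    {ν : Measure ℝ} (hν : ∀ x, ν (Iic x) = ENNReal.ofReal (gapCdf lam W x)) : HasLaw Y ν P := by
  have := isProbabilityMeasure_gapMeasure hlam
  have hγ := hX.measurePreserving_gap
  have hmap : P.map Y = (gapMeasure lam).map W := by
    rw [Measure.map_congr hY, ← hγ.map_eq, Measure.map_map hW hγ.measurable]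
    rfl
  have hYm : AEMeasurable Y P := (hW.comp hγ.measurable).aemeasurable.congr hY.symm
  refine ⟨hYm, ?_⟩
  have : IsProbabilityMeasure (P.map Y) := Measure.isProbabilityMeasure_map hYm
  refine Measure.ext_of_Iic _ _ fun x => ?_
  rw [hν, hmap, Measure.map_apply hW measurableSet_Iic, gapCdf, ofReal_measureReal]
  rfl

lemma gapCdf_comp {W : (ℕ → ℝ) → ℝ} (hW : Measurable W) {T : (ℕ → ℝ) → (ℕ → ℝ)}
    (hT : MeasurePreserving T (gapMeasure lam) (gapMeasure lam)) (x : ℝ) :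
    gapCdf lam (fun g => W (T g)) x = gapCdf lam W x :=
  hT.measureReal_preimage (measurableSet_le hW measurable_const).nullMeasurableSet

lemma hasLaw_cycleSum (hlam : 0 < lam) (hε : 0 < ε) (hX : IsPoissonProcess P lam X) (n : ℕ) :
    HasLaw (fun ω => cycleSum ε (fun j => X j ω) (n + 1))
      (volume.withDensity (fun x => ENNReal.ofReal
        (cycleSumDensity lam ε (clusterProb P X ε) (n + 1) x))) P := by
  refine hasLaw_of_gapCdf hlam hX
    (W := fun g => (fun h => lengthOfGaps ε h + startOfGaps ε n (gapsAfter ε h)) (tailSeq g))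
    (by fun_prop) ?_ fun x => ?_
  · filter_upwards [hX.ae_isRegular hlam hε] with ω hω
    have := cycleSum_succ_eq hω n
    rwa [pointsOfGaps_gap] at this
  obtain ⟨N, hN⟩ := exists_lt_natCast_mul hε x
  rw [gapCdf_comp (W := fun h => lengthOfGaps ε h + startOfGaps ε n (gapsAfter ε h)) (by fun_prop)
      (measurePreserving_tailSeq hlam), gapCdf_cycleSum hlam hε N n hN.le]
  unfold cycleSumDensity
  rw [withDensity_indicator_Iic, Nat.add_sub_cancel]
  rcases lt_or_ge x ε with hx | hx
  · rw [Ioc_eq_empty (not_lt.mpr hx.le), cdfSum_of_le hε N n hx.le]; simp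
  have hc : 0 ≤ lam * Real.exp (-(ε * lam)) := by positivity
  have hP : ∀ y ∈ Ioc ε x, clusterProb P X ε n (y - ε) =
      probSum (lam * Real.exp (-(ε * lam))) ε N n (y - ε) := fun y hy =>
    clusterProb_eq_probSum hlam hε hX n (by linarith [hy.1]) (by linarith [hy.2])
  have key := lintegral_Ioc_of_hasDerivAt hx (countable_singleton ε)
    (continuous_cdfSum (c := lam * Real.exp (-(ε * lam))) (ε := ε) N n)
    (fun y hy => hasDerivAt_cdfSum N n hy)
    ((((LeftBounded.probSum ε hc N n).comp_sub ε).const_mul _).intervalIntegrable ε x)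
    (fun y hy _ => by
      rw [← hP y hy]
      exact mul_nonneg hc measureReal_nonneg)
  rw [cdfSum_of_le hε N n le_rfl, sub_zero] at key
  rw [← key]
  exact setLIntegral_congr_fun measurableSet_Ioc fun y hy => by simp only [hP y hy]

/-- The derivative of the distribution function of a cluster length is its density. -/
lemma hasDerivAt_gapCdf_lengthOfGaps (hlam : 0 < lam) (hε : 0 < ε)
    (hX : IsPoissonProcess P lam X) {x : ℝ} (hx : ε < x) (hx2 : x ≠ 2 * ε) :
    HasDerivAt (gapCdf lam (lengthOfGaps ε))
      (lam * Real.exp (-(ε * lam)) * clusterProb P X ε 0 (x - ε)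
        + Real.exp (-(ε * lam)) * deriv (clusterProb P X ε 0) (x - ε)) x := by
  obtain ⟨N, hN⟩ := exists_lt_natCast_mul hε x
  have hne : x - ε ≠ ε := fun h => hx2 (by linarith)
  rw [clusterProb_eq_probSum hlam hε hX 0 (sub_nonneg.mpr hx.le) (show x - ε < N * ε by linarith)]
  have h1 := (hasDerivAt_clusterProb_zero hlam hε hX hne
    (show x - ε < N * ε by linarith)).differentiableAt.hasDerivAt.comp_sub_const x ε
  refine ((hasDerivAt_cdfSum (c := lam * Real.exp (-(ε * lam))) N 0 hx.ne').add
    (h1.const_mul (Real.exp (-(ε * lam))))).congr_of_eventuallyEq ?_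
  filter_upwards [gt_mem_nhds hN, lt_mem_nhds hx] with y hyN hyε
  rw [gapCdf_lengthOfGaps hlam hε N hyN.le, renewalSum, Pi.add_apply,
    clusterProb_eq_probSum hlam hε hX 0 (sub_nonneg.mpr hyε.le) (show y - ε < N * ε by linarith)]

lemma clusterLengthDensity_nonneg (hlam : 0 < lam) (hε : 0 < ε)
    (hX : IsPoissonProcess P lam X) (x : ℝ) :
    0 ≤ clusterLengthDensity lam ε (clusterProb P X ε) x := by
  refine indicator_nonneg (fun x (hx : ε < x) => ?_) x
  by_cases hx2 : x = 2 * ε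
  · have : x - ε = ε := by linarith
    rw [this, deriv_clusterProb_zero_self hlam hε hX, mul_zero, add_zero]
    exact mul_nonneg (by positivity) measureReal_nonneg
  · have hd := hasDerivAt_gapCdf_lengthOfGaps hlam hε hX hx hx2
    rw [← hd.deriv]
    exact (monotone_gapCdf hlam _).deriv_nonneg

lemma hasLaw_clusterLength (hlam : 0 < lam) (hε : 0 < ε) (hX : IsPoissonProcess P lam X) (i : ℕ) :
    HasLaw (fun ω => clusterLength ε (fun j => X j ω) i)
      (ENNReal.ofReal (Real.exp (-(ε * lam))) • Measure.dirac ε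
        + volume.withDensity (fun x => ENNReal.ofReal
          (clusterLengthDensity lam ε (clusterProb P X ε) x))) P := by
  have hT : MeasurePreserving (fun g => tailSeq ((gapsAfter ε ∘ tailSeq)^[i] g))
      (gapMeasure lam) (gapMeasure lam) :=
    (measurePreserving_tailSeq hlam).comp
      (((measurePreserving_gapsAfter hlam hε).comp (measurePreserving_tailSeq hlam)).iterate i)
  refine hasLaw_of_gapCdf hlam hX
    (W := fun g => lengthOfGaps ε (tailSeq ((gapsAfter ε ∘ tailSeq)^[i] g)))
    ((measurable_lengthOfGaps ε).comp hT.measurable) ?_ fun x => ?_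
  · filter_upwards [hX.ae_isRegular hlam hε] with ω hω
    have := clusterLength_eq hω i
    rwa [pointsOfGaps_gap] at this
  obtain ⟨N, hN⟩ := exists_lt_natCast_mul hε x
  rw [gapCdf_comp (measurable_lengthOfGaps ε) hT, gapCdf_lengthOfGaps hlam hε N hN.le,
    Measure.add_apply, Measure.smul_apply, Measure.dirac_apply' _ measurableSet_Iic]
  unfold clusterLengthDensity
  rw [withDensity_indicator_Iic]
  rcases lt_or_ge x ε with hx | hx
  · rw [Ioc_eq_empty (not_lt.mpr hx.le), renewalSum_of_lt hε N 0 hx]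
    simp [hx]
  have hc : 0 ≤ lam * Real.exp (-(ε * lam)) := by positivity
  set c := lam * Real.exp (-(ε * lam)) with hc_def
  -- A continuous function that agrees with the distribution function on `[ε, x]`.
  set F : ℝ → ℝ := fun y =>
    cdfSum c ε N 0 y + Real.exp (-(ε * lam)) * (1 - cdfSum c ε N 0 (y - ε)) with hF
  have hFc : Continuous F := by
    have := continuous_cdfSum (c := c) (ε := ε) N 0
    fun_prop
  have hFx : renewalSum lam ε N 0 x = F x := by
    change _ = cdfSum c ε N 0 x + Real.exp (-(ε * lam)) * (1 - cdfSum c ε N 0 (x - ε))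
    rw [renewalSum, ← hc_def, ← probSum_eq_of_lt hε 0 N.le_succ
        (show x - ε < N * ε by linarith),
      ← truncPow_zero_of_nonneg (c := c) (ε := ε) (sub_nonneg.mpr hx),
      ← probSum_zero_add_cdfSum N, add_sub_cancel_right]
  have hFε : F ε = Real.exp (-(ε * lam)) := by
    simp [hF, cdfSum_of_le hε N 0 le_rfl, cdfSum_of_le hε N 0 hε.le]
  have hFd : ∀ y ∉ ({ε, 2 * ε} : Set ℝ), HasDerivAt F (c * probSum c ε N 0 (y - ε)
      + Real.exp (-(ε * lam)) * (-(c * probSum c ε N 0 (y - ε - ε)))) y := by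
    intro y hy
    simp only [mem_insert_iff, mem_singleton_iff, not_or] at hy
    have hne : y - ε ≠ ε := fun h => hy.2 (by linarith)
    exact (hasDerivAt_cdfSum N 0 hy.1).add
      ((((hasDerivAt_cdfSum (c := c) N 0 hne).comp_sub_const y ε).const_sub 1).const_mul _)
  have hd : ∀ y ∈ Ioc ε x, y ∉ ({ε, 2 * ε} : Set ℝ) →
      lam * Real.exp (-(ε * lam)) * clusterProb P X ε 0 (y - ε)
        + Real.exp (-(ε * lam)) * deriv (clusterProb P X ε 0) (y - ε) =
      c * probSum c ε N 0 (y - ε)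
        + Real.exp (-(ε * lam)) * (-(c * probSum c ε N 0 (y - ε - ε))) := by
    intro y hy hys
    simp only [mem_insert_iff, mem_singleton_iff, not_or] at hys
    have hne : y - ε ≠ ε := fun h => hys.2 (by linarith)
    have hlt : y - ε < N * ε := by linarith [hy.2]
    rw [clusterProb_eq_probSum hlam hε hX 0 (sub_nonneg.mpr hy.1.le) hlt,
      (hasDerivAt_clusterProb_zero hlam hε hX hne hlt).deriv]
  have hcount : ({ε, 2 * ε} : Set ℝ).Countable := (toFinite _).countable
  have hP := (LeftBounded.probSum ε hc N 0).comp_sub ε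
  have key := lintegral_Ioc_of_hasDerivAt hx hcount hFc hFd
    (((hP.const_mul c).intervalIntegrable ε x).add
      ((((hP.comp_sub ε).const_mul c).const_mul (-Real.exp (-(ε * lam)))).intervalIntegrable
        ε x |>.congr (fun y _ => by simp)))
    (fun y hy hys => by
      have := clusterLengthDensity_nonneg hlam hε hX y
      rw [clusterLengthDensity, indicator_of_mem (show y ∈ Ioi ε from hy.1), hd y hy hys] at this
      exact this)
  have hlint : ∫⁻ y in Ioc ε x, ENNReal.ofReal
      (lam * Real.exp (-(ε * lam)) * clusterProb P X ε 0 (y - ε)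
        + Real.exp (-(ε * lam)) * deriv (clusterProb P X ε 0) (y - ε)) =
      ENNReal.ofReal (F x - F ε) := by
    rw [← key]
    refine lintegral_congr_ae ?_
    filter_upwards [ae_restrict_mem measurableSet_Ioc,
      ae_restrict_of_ae (hcount.ae_notMem volume)] with y hy hys
    rw [hd y hy hys]
  have hmono : F ε ≤ F x := by
    have h1 := monotone_gapCdf hlam (lengthOfGaps ε) hx
    rw [gapCdf_lengthOfGaps hlam hε N hN.le, hFx] at h1
    refine le_trans (le_of_eq ?_) h1
    have h2 : ε ≤ (1 : ℕ) * ε := by simp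
    rw [gapCdf_lengthOfGaps hlam hε 1 h2, renewalSum, cdfSum_of_le hε 1 0 le_rfl, hFε]
    simp [probSum, truncPow]
  rw [hlint, hFx, indicator_of_mem (show ε ∈ Iic x from hx), Pi.one_apply, smul_eq_mul, mul_one,
    ← hFε, ← ENNReal.ofReal_add (by rw [hFε]; positivity) (sub_nonneg.mpr hmono),
    add_sub_cancel]

/-! ### The explicit expressions -/

lemma natCast_mul_le_iff (hε : 0 < ε) {x : ℝ} (hx : 0 ≤ x) (k : ℕ) :
    k * ε ≤ x ↔ k ≤ ⌊x / ε⌋₊ := by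
  rw [Nat.le_floor_iff (by positivity), le_div_iff₀ hε]

lemma probSum_floor_eq (hε : 0 < ε) (c : ℝ) (n : ℕ) {x : ℝ} (hx : 0 ≤ x) :
    probSum c ε (⌊x / ε⌋₊ + 1) n x =
      1 / (n.factorial : ℝ) * ∑ i ∈ Finset.range (⌊x / ε⌋₊ + 1 - n),
        (-1 : ℝ) ^ i / (i.factorial : ℝ) * (c * (x - ((n : ℝ) + (i : ℝ)) * ε)) ^ (n + i) := by
  have hlow : ∀ k < n, (-1 : ℝ) ^ (k + n) * (k.choose n : ℝ) * truncPow c ε k x = 0 := by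
    intro k hk
    rw [Nat.choose_eq_zero_of_lt hk]; simp
  rcases le_or_gt n (⌊x / ε⌋₊ + 1) with h | h
  · obtain ⟨M, hM⟩ := Nat.exists_eq_add_of_le h
    rw [probSum, hM, Nat.add_sub_cancel_left, Finset.sum_range_add,
      Finset.sum_eq_zero fun k hk => hlow k (Finset.mem_range.mp hk), zero_add, Finset.mul_sum]
    refine Finset.sum_congr rfl fun i hi => ?_
    have hi' : n + i ≤ ⌊x / ε⌋₊ := by have := Finset.mem_range.mp hi; omega
    rw [truncPow_of_le ((natCast_mul_le_iff hε hx _).mpr hi'),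
      Nat.cast_add_choose]
    have h1 : ((n + i).factorial : ℝ) ≠ 0 := by positivity
    have h2 : (n.factorial : ℝ) ≠ 0 := by positivity
    have h3 : (i.factorial : ℝ) ≠ 0 := by positivity
    have h4 : (-1 : ℝ) ^ (n + i + n) = (-1) ^ i := by
      rw [show n + i + n = i + 2 * n by ring, pow_add, pow_mul]; simp
    rw [h4]
    push_cast
    field_simp
  · rw [Nat.sub_eq_zero_of_le h.le, Finset.range_zero, Finset.sum_empty, mul_zero, probSum]
    exact Finset.sum_eq_zero fun k hk => hlow k (by have := Finset.mem_range.mp hk; omega)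

lemma neg_mul_probSum_floor_eq (hε : 0 < ε) (c : ℝ) {x : ℝ} (hx : 0 ≤ x) :
    -(c * probSum c ε (⌊x / ε⌋₊ + 1) 0 (x - ε)) =
      ∑ i ∈ Finset.Icc 1 ⌊x / ε⌋₊,
        (-1 : ℝ) ^ i / ((i - 1).factorial : ℝ) * c * (c * (x - (i : ℝ) * ε)) ^ (i - 1) := by
  have hlt : x - ε < ⌊x / ε⌋₊ * ε := by
    have := (div_lt_iff₀ hε).mp (Nat.lt_floor_add_one (x / ε))
    linarith
  rw [probSum_eq_of_lt hε 0 (Nat.le_succ _) hlt, probSum, Finset.mul_sum, ← Finset.sum_neg_distrib]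
  refine Finset.sum_nbij' (· + 1) (· - 1) ?_ ?_ ?_ ?_ ?_
  · intro k hk; simp only [Finset.mem_range, Finset.mem_Icc] at *; omega
  · intro k hk; simp only [Finset.mem_range, Finset.mem_Icc] at *; omega
  · intro k _; simp
  · intro k hk; simp only [Finset.mem_Icc] at *; omega
  · intro k hk
    have h1 : ((k + 1 : ℕ) : ℝ) * ε ≤ x := (natCast_mul_le_iff hε hx _).mpr (Finset.mem_range.mp hk)
    have h2 : x - ((k + 1 : ℕ) : ℝ) * ε = x - ε - k * ε := by push_cast; ring
    rw [truncPow_of_le (by linarith), Nat.add_sub_cancel, h2, Nat.choose_zero_right, add_zero,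
      pow_succ]
    push_cast
    ring

end Probability

end SensorClusters

theorem mainTheorem8 {Ω : Type*} [MeasurableSpace Ω] (P : Measure Ω) [IsProbabilityMeasure P]
    (lam ε : ℝ) (hlam : 0 < lam) (hε : 0 < ε) (X : ℕ → Ω → ℝ)
    (hX : SensorClusters.IsPoissonProcess P lam X) :
    -- the law of every cluster length: an atom at `ε` and a density on `(ε, ∞)`
    (∀ i : ℕ, HasLaw (fun ω => SensorClusters.clusterLength ε (fun j => X j ω) i)
      (ENNReal.ofReal (Real.exp (-(ε * lam))) • Measure.dirac ε
        + volume.withDensity (fun x => ENNReal.ofReal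
          (SensorClusters.clusterLengthDensity lam ε (SensorClusters.clusterProb P X ε) x))) P) ∧
    (∀ x : ℝ,
      0 ≤ SensorClusters.clusterLengthDensity lam ε (SensorClusters.clusterProb P X ε) x) ∧
    -- the law of every cumulative cycle length
    (∀ n : ℕ, 1 ≤ n → HasLaw (fun ω => SensorClusters.cycleSum ε (fun j => X j ω) n)
      (volume.withDensity (fun x => ENNReal.ofReal
        (SensorClusters.cycleSumDensity lam ε (SensorClusters.clusterProb P X ε) n x))) P) ∧
    -- the explicit expressions of `p_n` and of the derivative of `p_0`
    (∀ (n : ℕ) (x : ℝ), 0 ≤ x →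
      SensorClusters.clusterProb P X ε n x
        = 1 / (n.factorial : ℝ) * ∑ i ∈ Finset.range (⌊x / ε⌋₊ + 1 - n),
            (-1 : ℝ) ^ i / (i.factorial : ℝ)
              * ((x - ((n : ℝ) + (i : ℝ)) * ε) * lam * Real.exp (-(lam * ε))) ^ (n + i)) ∧
    (∀ x : ℝ, 0 < x → x ≠ ε →
      HasDerivAt (SensorClusters.clusterProb P X ε 0)
        (∑ i ∈ Finset.Icc 1 ⌊x / ε⌋₊,
          (-1 : ℝ) ^ i / ((i - 1).factorial : ℝ) * (lam * Real.exp (-(lam * ε)))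
            * ((x - (i : ℝ) * ε) * lam * Real.exp (-(lam * ε))) ^ (i - 1)) x) := by
  refine ⟨SensorClusters.hasLaw_clusterLength hlam hε hX,
    SensorClusters.clusterLengthDensity_nonneg hlam hε hX, fun n hn => ?_, fun n x hx => ?_,
    fun x hx hxε => ?_⟩
  · obtain ⟨m, rfl⟩ := Nat.exists_eq_add_of_le' hn
    exact SensorClusters.hasLaw_cycleSum hlam hε hX m
  · have hlt : x < (⌊x / ε⌋₊ + 1 : ℕ) * ε := by
      have := (div_lt_iff₀ hε).mp (Nat.lt_floor_add_one (x / ε))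
      exact_mod_cast this
    rw [SensorClusters.clusterProb_eq_probSum hlam hε hX n hx hlt,
      SensorClusters.probSum_floor_eq hε _ n hx, mul_comm ε lam]
    congr 1
    refine Finset.sum_congr rfl fun i _ => ?_
    ring_nf
  · have hlt : x < (⌊x / ε⌋₊ + 1 : ℕ) * ε := by
      have := (div_lt_iff₀ hε).mp (Nat.lt_floor_add_one (x / ε))
      exact_mod_cast this
    refine (SensorClusters.hasDerivAt_clusterProb_zero hlam hε hX hxε hlt).congr_deriv ?_
    rw [SensorClusters.neg_mul_probSum_floor_eq hε _ hx.le, mul_comm ε lam]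
    refine Finset.sum_congr rfl fun i _ => ?_
    congr 2
    ring
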